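/- Let $L\subset S^3$ be a link, i.e. the disjoint union of the images of finitely many smooth embeddings of the circle in the $3$-sphere, and let $p\colon\Sigma(L)\to S^3$ be the double cover of $S^3$ branched along $L$: the map $p$ is continuous, it is a two-sheeted covering over $S^3\smallsetminus L$, and every point of $L$ has an open neighbourhood $U$ with homeomorphisms $U\cong\mathbb C\times\mathbb R$, carrying $L\cap U$ to $\{0\}\times\mathbb R$, and $p^{-1}(U)\cong\mathbb C\times\mathbb R$, under which $p$ becomes $(z,t)\mapsto(z^2,t)$. Let $[\Sigma(L)]\in H_3(\Sigma(L);\mathbb Z)$ be a fundamental class of the closed $3$-manifold $\Sigma(L)$, that is, a class whose image generates $H_3(\Sigma(L),\Sigma(L)\smallsetminus\{x\};\mathbb Z)$ for every point $x$. Then the triple cup product form of $\Sigma(L)$ vanishes identically: $$\langle\alpha\cup\beta\cup\gamma,\,[\Sigma(L)]\rangle=0\qquad\text{for all }\alpha,\beta,\gamma\in H^1(\Sigma(L);\mathbb Z).$$ -/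

import Mathlib

open CategoryTheory AlgebraicTopology

noncomputable section

/-! ### Cohomology of simplicial sets with integer coefficients, and the cup product -/

namespace SimplicialCohomology

section

open scoped Simplicial

variable (K : SSet.{0})

/-- Integral `n`-cochains: functions on the `n`-simplices. -/
abbrev Cochain (n : ℕ) : Type := K _⦋n⦌ → ℤ

/-- The coboundary `(δφ)(σ) = ∑ i, (-1)^i φ(∂ᵢ σ)`. -/
def coboundary (n : ℕ) : Cochain K n →+ Cochain K (n + 1) where
  toFun φ := fun σ => ∑ i : Fin (n + 2), (-1) ^ (i : ℕ) * φ (K.δ i σ)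
  map_zero' := by
    funext σ
    simp
  map_add' φ ψ := by
    funext σ
    simp [mul_add, Finset.sum_add_distrib]

/-- The group of `n`-cocycles. -/
def cocycles (n : ℕ) : AddSubgroup (Cochain K n) := (coboundary K n).ker

end

section

variable (K : SSet.{0})

/-- The group of `n`-coboundaries. -/
def coboundaries : (n : ℕ) → AddSubgroup (Cochain K n)
  | 0 => ⊥
  | n + 1 => (coboundary K n).range

/-- The integral cohomology group `Hⁿ(K; ℤ)`: cocycles modulo coboundaries. -/
abbrev Cohomology (n : ℕ) : Type :=
  cocycles K n ⧸ (coboundaries K n).addSubgroupOf (cocycles K n)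

end

section

open scoped Simplicial

/-- The inclusion of `[0, …, p]` in `[0, …, n]` onto the first `p + 1` vertices. -/
def front {p n : ℕ} (h : p ≤ n) : ⦋p⦌ ⟶ ⦋n⦌ :=
  SimplexCategory.mkHom
    ⟨fun i => ⟨i, by omega⟩, fun i j hij => by simpa using hij⟩

/-- The inclusion of `[0, …, q]` in `[0, …, n]` onto the vertices `p, …, p + q`. -/
def back {p q n : ℕ} (h : p + q = n) : ⦋q⦌ ⟶ ⦋n⦌ :=
  SimplexCategory.mkHom
    ⟨fun i => ⟨p + i, by omega⟩, fun i j hij => by simpa using hij⟩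

variable {K : SSet.{0}}

/-- The (Alexander–Whitney) cup product of cochains:
`(φ ∪ ψ)(σ) = φ(σ|[v₀, …, v_p]) ψ(σ|[v_p, …, v_{p+q}])`. -/
def cupCochain {p q n : ℕ} (h : p + q = n) (φ : Cochain K p) (ψ : Cochain K q) :
    Cochain K n :=
  fun σ => φ (K.map (front (show p ≤ n by omega)).op σ) * ψ (K.map (back h).op σ)

lemma simplexHom_ext {a b : ℕ} {f g : ⦋a⦌ ⟶ ⦋b⦌}
    (h : ∀ j : Fin (a + 1), (f.toOrderHom j : ℕ) = g.toOrderHom j) : f = g :=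
  SimplexCategory.Hom.ext _ _ (OrderHom.ext _ _ (funext fun j => Fin.ext (h j)))

lemma delta_val {a : ℕ} (i : Fin (a + 2)) (j : Fin (a + 1)) :
    ((SimplexCategory.δ i).toOrderHom j : ℕ) = if (j : ℕ) < i then (j : ℕ) else j + 1 := by
  change ((i.succAbove j : Fin (a + 2)) : ℕ) = _
  simp only [Fin.succAbove, Fin.lt_def, Fin.val_castSucc]
  split_ifs <;> rfl

lemma comp_delta_val {a b : ℕ} (f : ⦋a⦌ ⟶ ⦋b⦌) (i : Fin (b + 2)) (j : Fin (a + 1)) :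
    ((f ≫ SimplexCategory.δ i).toOrderHom j : ℕ) =
      if (f.toOrderHom j : ℕ) < i then (f.toOrderHom j : ℕ) else f.toOrderHom j + 1 :=
  delta_val i (f.toOrderHom j)

lemma front_val {p n : ℕ} (h : p ≤ n) (j : Fin (p + 1)) :
    ((front h).toOrderHom j : ℕ) = j := rfl

lemma back_val {p q n : ℕ} (h : p + q = n) (j : Fin (q + 1)) :
    ((back h).toOrderHom j : ℕ) = p + j := rfl

lemma comp_front_val {a p n : ℕ} (f : ⦋a⦌ ⟶ ⦋p⦌) (h : p ≤ n) (j : Fin (a + 1)) :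
    ((f ≫ front h).toOrderHom j : ℕ) = f.toOrderHom j := rfl

lemma comp_back_val {a p q n : ℕ} (f : ⦋a⦌ ⟶ ⦋q⦌) (h : p + q = n) (j : Fin (a + 1)) :
    ((f ≫ back h).toOrderHom j : ℕ) = p + f.toOrderHom j := rfl

lemma front_delta_le {p n : ℕ} (h : p ≤ n) (i : Fin (n + 2)) (hi : (i : ℕ) ≤ p) :
    front h ≫ SimplexCategory.δ i =
      SimplexCategory.δ (⟨i, by omega⟩ : Fin (p + 2)) ≫ front (show p + 1 ≤ n + 1 by omega) := by
  refine simplexHom_ext fun j => ?_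
  rw [comp_delta_val, front_val, comp_front_val, delta_val]

lemma front_delta_gt {p n : ℕ} (h : p ≤ n) (i : Fin (n + 2)) (hi : p < (i : ℕ)) :
    front h ≫ SimplexCategory.δ i = front (show p ≤ n + 1 by omega) := by
  refine simplexHom_ext fun j => ?_
  rw [comp_delta_val, front_val, front_val, if_pos (by omega)]

lemma back_delta_le {p q n : ℕ} (h : p + q = n) (i : Fin (n + 2)) (hi : (i : ℕ) ≤ p) :
    back h ≫ SimplexCategory.δ i = back (show (p + 1) + q = n + 1 by omega) := by
  refine simplexHom_ext fun j => ?_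
  rw [comp_delta_val, back_val, back_val, if_neg (by omega)]
  omega

lemma back_delta_gt {p q n : ℕ} (h : p + q = n) (i : Fin (q + 2)) :
    back h ≫ SimplexCategory.δ (⟨p + i, by omega⟩ : Fin (n + 2)) =
      SimplexCategory.δ i ≫ back (show p + (q + 1) = n + 1 by omega) := by
  refine simplexHom_ext fun j => ?_
  rw [comp_delta_val, back_val, comp_back_val, delta_val]
  simp only [add_lt_add_iff_left]
  split_ifs <;> omega

lemma last_delta_front {p n : ℕ} (h : p + 1 ≤ n) :
    SimplexCategory.δ (Fin.last (p + 1)) ≫ front h = front (show p ≤ n by omega) := by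
  refine simplexHom_ext fun j => ?_
  rw [comp_front_val, delta_val, front_val, if_pos (by simp; omega)]

lemma zero_delta_back {p q n : ℕ} (h : p + (q + 1) = n) :
    SimplexCategory.δ (0 : Fin (q + 2)) ≫ back h = back (show (p + 1) + q = n by omega) := by
  refine simplexHom_ext fun j => ?_
  rw [comp_back_val, delta_val, back_val, if_neg (by simp)]
  omega

/-- The Leibniz rule `δ(φ ∪ ψ) = δφ ∪ ψ + (-1)^p φ ∪ δψ`. -/
theorem coboundary_cupCochain {p q n : ℕ} (h : p + q = n) (φ : Cochain K p) (ψ : Cochain K q) :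
    coboundary K n (cupCochain h φ ψ) =
      cupCochain (show (p + 1) + q = n + 1 by omega) (coboundary K p φ) ψ +
      (-1) ^ p • cupCochain (show p + (q + 1) = n + 1 by omega) φ (coboundary K q ψ) := by
  subst h
  funext σ
  have e : ∀ {a b : ℕ} (f : ⦋a⦌ ⟶ ⦋b⦌) (i : Fin (b + 2)) (s : K _⦋b + 1⦌),
      K.map f.op (K.δ i s) = K.map (f ≫ SimplexCategory.δ i).op s := by
    intro a b f i s
    simp [SimplicialObject.δ]
  have e' : ∀ {a b : ℕ} (f : ⦋a + 1⦌ ⟶ ⦋b⦌) (i : Fin (a + 2)) (s : K _⦋b⦌),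
      K.δ i (K.map f.op s) = K.map (SimplexCategory.δ i ≫ f).op s := by
    intro a b f i s
    simp [SimplicialObject.δ]
  have hs : (p + 1) + (q + 1) = p + q + 2 := by omega
  simp only [coboundary, AddMonoidHom.coe_mk, ZeroHom.coe_mk, cupCochain, Pi.add_apply,
    Pi.smul_apply, smul_eq_mul, e, e']
  rw [← Fin.sum_congr' _ hs, Fin.sum_univ_add, Fin.sum_univ_castSucc (n := p + 1),
    Fin.sum_univ_succ (n := q + 1)]
  have h1 : ∀ i : Fin (p + 1),
      (front (show p ≤ p + q by omega) ≫ SimplexCategory.δ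
        (Fin.cast hs (Fin.castAdd (q + 1) i))) =
      SimplexCategory.δ i.castSucc ≫ front (show p + 1 ≤ p + q + 1 by omega) := fun i =>
    front_delta_le _ _ (by simp; omega)
  have h2 : ∀ i : Fin (p + 1),
      (back (show p + q = p + q by rfl) ≫ SimplexCategory.δ
        (Fin.cast hs (Fin.castAdd (q + 1) i))) =
      back (show (p + 1) + q = p + q + 1 by omega) := fun i =>
    back_delta_le _ _ (by simp; omega)
  have h3 : ∀ i : Fin (q + 1),
      (front (show p ≤ p + q by omega) ≫ SimplexCategory.δ
        (Fin.cast hs (Fin.natAdd (p + 1) i))) =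
      front (show p ≤ p + q + 1 by omega) := fun i =>
    front_delta_gt _ _ (by simp; omega)
  have h4 : ∀ i : Fin (q + 1),
      (back (show p + q = p + q by rfl) ≫ SimplexCategory.δ
        (Fin.cast hs (Fin.natAdd (p + 1) i))) =
      SimplexCategory.δ i.succ ≫ back (show p + (q + 1) = p + q + 1 by omega) := by
    intro i
    rw [← back_delta_gt (rfl : p + q = p + q) i.succ]
    congr 2
    ext
    simp
    omega
  simp only [h1, h2, h3, h4, last_delta_front, zero_delta_back, Fin.val_cast, Fin.val_castAdd,
    Fin.val_natAdd, Fin.val_last, Fin.val_succ, Fin.val_castSucc, Fin.val_zero, mul_add, add_mul,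
    Finset.mul_sum, Finset.sum_mul]
  have h5 : ∀ A B : ℤ, (-1 : ℤ) ^ (p + 1) * A * B + (-1) ^ p * (A * ((-1) ^ 0 * B)) = 0 := by
    intro A B
    ring
  have h6 := h5 (φ (K.map (front (show p ≤ p + q + 1 by omega)).op σ))
    (ψ (K.map (back (show (p + 1) + q = p + q + 1 by omega)).op σ))
  have h7 : ∀ X Y a b : ℤ, a + b = 0 → X + Y = X + a + (b + Y) := by
    intro X Y a b hab
    linarith
  refine Eq.trans ?_ (h7 _ _ _ _ h6)
  congr 1
  · exact Finset.sum_congr rfl fun i _ => by ring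
  · exact Finset.sum_congr rfl fun i _ => by ring

lemma cupCochain_add_left {p q n : ℕ} (h : p + q = n) (φ φ' : Cochain K p) (ψ : Cochain K q) :
    cupCochain h (φ + φ') ψ = cupCochain h φ ψ + cupCochain h φ' ψ := by
  funext σ
  simp [cupCochain, add_mul]

lemma cupCochain_add_right {p q n : ℕ} (h : p + q = n) (φ : Cochain K p) (ψ ψ' : Cochain K q) :
    cupCochain h φ (ψ + ψ') = cupCochain h φ ψ + cupCochain h φ ψ' := by
  funext σ
  simp [cupCochain, mul_add]

lemma cupCochain_zero_left {p q n : ℕ} (h : p + q = n) (ψ : Cochain K q) :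
    cupCochain h (0 : Cochain K p) ψ = 0 := by
  funext σ
  simp [cupCochain]

lemma cupCochain_zero_right {p q n : ℕ} (h : p + q = n) (φ : Cochain K p) :
    cupCochain h φ (0 : Cochain K q) = 0 := by
  funext σ
  simp [cupCochain]

lemma cupCochain_mem_cocycles {p q n : ℕ} (h : p + q = n) {φ : Cochain K p} {ψ : Cochain K q}
    (hφ : φ ∈ cocycles K p) (hψ : ψ ∈ cocycles K q) : cupCochain h φ ψ ∈ cocycles K n := by
  rw [cocycles, AddMonoidHom.mem_ker] at *
  rw [coboundary_cupCochain, hφ, hψ, cupCochain_zero_left, cupCochain_zero_right, smul_zero,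
    add_zero]

lemma cupCochain_mem_coboundaries_right {p q n : ℕ} (h : p + q = n) {φ : Cochain K p}
    {ψ : Cochain K q} (hφ : φ ∈ cocycles K p) (hψ : ψ ∈ coboundaries K q) :
    cupCochain h φ ψ ∈ coboundaries K n := by
  cases q with
  | zero =>
    obtain rfl : ψ = 0 := hψ
    rw [cupCochain_zero_right]
    exact zero_mem _
  | succ q =>
    obtain ⟨ψ', rfl⟩ := hψ
    subst h
    refine ⟨(-1) ^ p • cupCochain rfl φ ψ', ?_⟩
    rw [cocycles, AddMonoidHom.mem_ker] at hφ
    rw [map_zsmul, coboundary_cupCochain, hφ, cupCochain_zero_left, zero_add, smul_smul,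
      ← mul_pow]
    simp

lemma cupCochain_mem_coboundaries_left {p q n : ℕ} (h : p + q = n) {φ : Cochain K p}
    {ψ : Cochain K q} (hφ : φ ∈ coboundaries K p) (hψ : ψ ∈ cocycles K q) :
    cupCochain h φ ψ ∈ coboundaries K n := by
  cases p with
  | zero =>
    obtain rfl : φ = 0 := hφ
    rw [cupCochain_zero_left]
    exact zero_mem _
  | succ p =>
    obtain ⟨φ', rfl⟩ := hφ
    obtain rfl : n = p + q + 1 := by omega
    refine ⟨cupCochain rfl φ' ψ, ?_⟩
    rw [cocycles, AddMonoidHom.mem_ker] at hψ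
    rw [coboundary_cupCochain, hψ, cupCochain_zero_right, smul_zero, add_zero]

/-- The class in `Hⁿ` of the cup product of two cocycles. -/
def cupCocycles {p q n : ℕ} (h : p + q = n) (φ : cocycles K p) :
    cocycles K q →+ Cohomology K n :=
  (QuotientAddGroup.mk' _).comp
    { toFun := fun ψ => (⟨cupCochain h φ ψ, cupCochain_mem_cocycles h φ.2 ψ.2⟩ : cocycles K n)
      map_zero' := Subtype.ext (cupCochain_zero_right h _)
      map_add' := fun _ _ => Subtype.ext (cupCochain_add_right h _ _ _) }

/-- The cup product of a cocycle with a cohomology class. -/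
def cupCocycle {p q n : ℕ} (h : p + q = n) (φ : cocycles K p) :
    Cohomology K q →+ Cohomology K n :=
  QuotientAddGroup.lift _ (cupCocycles h φ) fun _ hψ =>
    (QuotientAddGroup.eq_zero_iff _).2 (cupCochain_mem_coboundaries_right h φ.2 hψ)

/-- The cup product `Hᵖ(K; ℤ) × H^q(K; ℤ) → Hⁿ(K; ℤ)`, where `p + q = n`. -/
def cup {p q n : ℕ} (h : p + q = n) : Cohomology K p →+ Cohomology K q →+ Cohomology K n :=
  QuotientAddGroup.lift _
    (AddMonoidHom.mk' (cupCocycle h) fun φ φ' => by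
      ext ψ
      exact congrArg (QuotientAddGroup.mk' _)
        (Subtype.ext (cupCochain_add_left h (φ : Cochain K p) φ' ψ)))
    fun φ hφ => by
      ext ψ
      exact (QuotientAddGroup.eq_zero_iff _).2 (cupCochain_mem_coboundaries_left h hφ ψ.2)

/-- The integral chain complex of a simplicial set. -/
abbrev Chains (K : SSet.{0}) : ChainComplex (ModuleCat.{0} ℤ) ℕ :=
  K.chainComplex (ModuleCat.of ℤ ℤ)

/-- The linear extension of a cochain to a map `Cₙ(K; ℤ) → ℤ`. -/
def evalChain {n : ℕ} (φ : Cochain K n) : (Chains K).X n ⟶ ModuleCat.of ℤ ℤ :=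
  Limits.Cofan.IsColimit.desc (K.isColimitChainComplexXCofan (ModuleCat.of ℤ ℤ) n)
    fun σ => ModuleCat.ofHom (φ σ • LinearMap.id)

lemma ι_evalChain {n : ℕ} (φ : Cochain K n) (σ : K _⦋n⦌) :
    K.ιChainComplex σ ≫ evalChain φ = ModuleCat.ofHom (φ σ • LinearMap.id) :=
  Limits.Cofan.IsColimit.fac (K.isColimitChainComplexXCofan (ModuleCat.of ℤ ℤ) n) _ σ

lemma evalChain_add {n : ℕ} (φ ψ : Cochain K n) :
    evalChain (φ + ψ) = evalChain φ + evalChain ψ := by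
  refine SSet.chainComplex_hom_ext fun σ => ?_
  rw [Preadditive.comp_add, ι_evalChain, ι_evalChain, ι_evalChain, Pi.add_apply, add_smul]
  rfl

lemma d_evalChain {n : ℕ} (φ : Cochain K n) :
    (Chains K).d (n + 1) n ≫ evalChain φ = evalChain (coboundary K n φ) := by
  refine SSet.chainComplex_hom_ext fun σ => ?_
  rw [SSet.ιChainComplex_d_assoc, ι_evalChain, Preadditive.sum_comp]
  ext
  simp [coboundary, ι_evalChain]

lemma evalChain_injective {n : ℕ} {φ ψ : Cochain K n} (h : evalChain φ = evalChain ψ) :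
    φ = ψ := by
  funext σ
  have h' := (ι_evalChain φ σ).symm.trans
    ((congrArg (K.ιChainComplex σ ≫ ·) h).trans (ι_evalChain ψ σ))
  simpa using LinearMap.congr_fun (congrArg ModuleCat.Hom.hom h') (1 : ℤ)

lemma coboundaries_le_cocycles (n : ℕ) : coboundaries K n ≤ cocycles K n := by
  intro φ hφ
  cases n with
  | zero =>
    obtain rfl : φ = 0 := hφ
    exact zero_mem _
  | succ n =>
    obtain ⟨ψ, rfl⟩ := hφ
    refine evalChain_injective ?_
    have h0 : evalChain (0 : Cochain K (n + 1 + 1)) = 0 := by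
      simpa using evalChain_add (0 : Cochain K (n + 1 + 1)) 0
    rw [← d_evalChain, ← d_evalChain, HomologicalComplex.d_comp_d_assoc, Limits.zero_comp, h0]

/-- The evaluation of a cocycle on homology classes. -/
def evalCocycle {n : ℕ} (φ : cocycles K n) : (Chains K).homology n ⟶ ModuleCat.of ℤ ℤ :=
  (Chains K).homologyι n ≫ (Chains K).descOpcycles (evalChain (φ : Cochain K n)) (n + 1)
    (ChainComplex.prev ℕ n) (by
      have h : coboundary K n φ = 0 := φ.2
      rw [d_evalChain, h]
      refine SSet.chainComplex_hom_ext fun σ => ?_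
      rw [ι_evalChain, Limits.comp_zero]
      ext
      simp)

lemma evalCocycle_add {n : ℕ} (φ ψ : cocycles K n) :
    evalCocycle (φ + ψ) = evalCocycle φ + evalCocycle ψ := by
  rw [evalCocycle, evalCocycle, evalCocycle, ← Preadditive.comp_add]
  congr 1
  rw [← cancel_epi ((Chains K).pOpcycles n), Preadditive.comp_add]
  simp only [HomologicalComplex.p_descOpcycles]
  exact evalChain_add _ _

lemma evalCocycle_eq_zero {n : ℕ} (φ : cocycles K n)
    (hφ : (φ : Cochain K n) ∈ coboundaries K n) : evalCocycle φ = 0 := by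
  cases n with
  | zero =>
    obtain rfl : φ = 0 := Subtype.ext hφ
    simpa using evalCocycle_add (0 : cocycles K 0) 0
  | succ n =>
    obtain ⟨ψ, hψ⟩ := hφ
    have : (Chains K).descOpcycles (evalChain (φ : Cochain K (n + 1))) (n + 1 + 1)
        (ChainComplex.prev ℕ (n + 1)) (by
          rw [← hψ, ← d_evalChain, HomologicalComplex.d_comp_d_assoc, Limits.zero_comp]) =
        (Chains K).fromOpcycles (n + 1) n ≫ evalChain ψ := by
      rw [← cancel_epi ((Chains K).pOpcycles (n + 1)), HomologicalComplex.p_descOpcycles,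
        HomologicalComplex.p_fromOpcycles_assoc, d_evalChain, hψ]
    rw [evalCocycle, this, HomologicalComplex.homologyι_comp_fromOpcycles_assoc,
      Limits.zero_comp]

/-- The Kronecker pairing `⟨a, c⟩` of `a ∈ Hⁿ(K; ℤ)` with `c ∈ Hₙ(K; ℤ)`. -/
def kronecker {n : ℕ} : Cohomology K n →+ ((Chains K).homology n →+ ℤ) :=
  QuotientAddGroup.lift _
    (AddMonoidHom.mk' (fun φ => (evalCocycle φ).hom.toAddMonoidHom) fun φ ψ => by
      rw [evalCocycle_add]
      rfl)
    fun φ hφ => by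
      change (evalCocycle φ).hom.toAddMonoidHom = 0
      rw [evalCocycle_eq_zero φ hφ]
      rfl

end

end SimplicialCohomology

/-! ### Singular homology and cohomology of spaces, the triple cup product form -/

namespace Singular

variable (X : Type) [TopologicalSpace X]

/-- The integral singular chain complex of a space. -/
abbrev chains : ChainComplex (ModuleCat.{0} ℤ) ℕ :=
  ((singularChainComplexFunctor (ModuleCat.{0} ℤ)).obj (ModuleCat.of ℤ ℤ)).obj (TopCat.of X)

/-- The integral singular homology group `Hₙ(X; ℤ)`. -/
abbrev Homology (n : ℕ) : ModuleCat.{0} ℤ := (chains X).homology n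

/-- The integral singular cohomology group `Hⁿ(X; ℤ)`. -/
abbrev Cohomology (n : ℕ) : Type :=
  SimplicialCohomology.Cohomology (TopCat.toSSet.obj (TopCat.of X)) n

variable {X}

/-- The cup product on singular cohomology. -/
def cup {p q n : ℕ} (h : p + q = n) : Cohomology X p →+ Cohomology X q →+ Cohomology X n :=
  SimplicialCohomology.cup h

/-- The evaluation `⟨a, c⟩` of a singular cohomology class on a singular homology class. -/
def kronecker {n : ℕ} (a : Cohomology X n) (c : Homology X n) : ℤ :=
  SimplicialCohomology.kronecker a c

/-- The map of singular chain complexes induced by the inclusion of a subspace. -/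
def chainsIncl (A : Set X) : chains A ⟶ chains X :=
  ((singularChainComplexFunctor (ModuleCat.{0} ℤ)).obj (ModuleCat.of ℤ ℤ)).map
    (TopCat.ofHom ⟨((↑) : A → X), continuous_subtype_val⟩)

/-- The relative singular chain complex `C(X, A) = C(X) / C(A)`. -/
def relChains (A : Set X) : ChainComplex (ModuleCat.{0} ℤ) ℕ := Limits.cokernel (chainsIncl A)

/-- The relative singular homology group `Hₙ(X, A; ℤ)`. -/
abbrev RelHomology (A : Set X) (n : ℕ) : ModuleCat.{0} ℤ := (relChains A).homology n

/-- The natural map `Hₙ(X; ℤ) → Hₙ(X, A; ℤ)`. -/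
def toRel (A : Set X) (n : ℕ) : Homology X n ⟶ RelHomology A n :=
  HomologicalComplex.homologyMap (Limits.cokernel.π (chainsIncl A)) n

/-- `μ ∈ Hₙ(X; ℤ)` is a fundamental class of the closed `n`-manifold `X` (for one of its
orientations): for every point `x`, the image of `μ` generates the local homology group
`Hₙ(X, X ∖ {x}; ℤ)`. -/
def IsFundamentalClass {n : ℕ} (μ : Homology X n) : Prop :=
  ∀ (x : X) (a : RelHomology ({x}ᶜ : Set X) n), ∃ k : ℤ, a = k • (toRel {x}ᶜ n).hom μ

/-- The triple cup product form `(α, β, γ) ↦ ⟨α ∪ β ∪ γ, μ⟩` on `H¹(X; ℤ)`, for `μ ∈ H₃(X; ℤ)`. -/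
def tripleCupForm (μ : Homology X 3) (α β γ : Cohomology X 1) : ℤ :=
  kronecker (cup (show 2 + 1 = 3 from rfl) (cup (show 1 + 1 = 2 from rfl) α β) γ) μ

end Singular

/-! ### Links in the 3-sphere and their double branched covers -/

section

open scoped Manifold ContDiff

/-- The unit 3-sphere in `ℝ⁴`. -/
abbrev ThreeSphere : Type := Metric.sphere (0 : EuclideanSpace ℝ (Fin 4)) 1

/-- A link in `S³` with `n` components: smoothly embedded circles with disjoint images. -/
structure SmoothLink (n : ℕ) where
  /-- The components. -/
  component : Fin n → Circle → ThreeSphere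
  isSmoothEmbedding : ∀ i, Manifold.IsSmoothEmbedding (𝓡 1) (𝓡 3) ∞ (component i)
  disjoint : Pairwise fun i j =>
    Disjoint (Set.range (component i)) (Set.range (component j))

/-- The underlying set of a link. -/
def SmoothLink.carrier {n : ℕ} (L : SmoothLink n) : Set ThreeSphere :=
  ⋃ i, Set.range (L.component i)

/-- `p : Y → S³` is the double cover of `S³` branched along the link `L`: it is a two-sheeted
covering over the complement of `L`, and every point of `L` has an open neighbourhood `U` such
that, in suitable coordinates `U ≅ ℂ × ℝ` in which `L` is `{0} × ℝ` and `p⁻¹(U) ≅ ℂ × ℝ`, the map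
`p` is `(z, t) ↦ (z², t)`. -/
structure IsDoubleBranchedCover {Y : Type} [TopologicalSpace Y] {n : ℕ} (L : SmoothLink n)
    (p : Y → ThreeSphere) : Prop where
  continuous : Continuous p
  isCoveringMapOn : IsCoveringMapOn p L.carrierᶜ
  encard_fiber : ∀ x ∉ L.carrier, (p ⁻¹' {x}).encard = 2
  branched : ∀ x ∈ L.carrier, ∃ U : Set ThreeSphere, IsOpen U ∧ x ∈ U ∧
    ∃ (e : U ≃ₜ ℂ × ℝ) (e' : p ⁻¹' U ≃ₜ ℂ × ℝ),
      (∀ u : U, (u : ThreeSphere) ∈ L.carrier ↔ (e u).1 = 0) ∧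
      ∀ y : p ⁻¹' U, e ⟨p y, y.2⟩ = ((e' y).1 ^ 2, (e' y).2)

end

end

/-! The stronger fact is that `2 (α ∪ β) = 0` already in `H²(Y; ℤ)`; since `ℤ` has no torsion, every
triple product containing `α ∪ β` then vanishes.

A degree one class is represented by a map to the circle. If `a` represents `α` and `τ` is the deck
involution, then `a · (a ∘ τ)` is invariant and descends to the 3-sphere, where every circle-valued
map has a continuous argument (`HasArg.sphere`). Dividing `a` by the exponential of half that
argument leaves its class unchanged and gives `a ∘ τ = a⁻¹` (`exists_represents_inv`). With `b`
chosen likewise for `β`, the map `(a, b)` from `Y` to the torus intertwines `τ` with inversion.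

The quotient of the torus by inversion is the pillowcase, a 2-sphere, and the quotient map has
degree two. A line bundle of degree `±1` on the pillowcase therefore pulls back to one of degree
`±2` on the torus, whose pullback along `(a, b)` has first Chern class `±2 (α ∪ β)`. It also comes
from a line bundle on the 3-sphere, which is trivial. Hence `2 (α ∪ β) = 0`.

The proof makes this explicit and needs no Chern classes. The bundle on the torus is the line
spanned in `ℂ²` by `torusFrame t b`, with `exp (i t)` as first coordinate; a turn in `t` multiplies
the frame by `b²`, and inversion fixes it. The projections onto these lines descend to the 3-sphere,
where `exists_section_sphere` supplies a nowhere vanishing section `s`. The inner product of `s`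
with the frame is a function `G` that does not vanish on the infinite cyclic cover defined by `a`
and is multiplied by `b²` under its deck transformation. Comparing arguments of `G` along lifted
edges yields an integral cochain with coboundary `2 φ ∪ ψ`
(`Singular.two_smul_cupCochain_mem_coboundaries`). -/

open scoped InnerProductSpace

/-! ### Real lifts of circle-valued maps -/

/-- Every circle-valued map on `X` has a continuous argument. -/
def HasArg (X : Type*) [TopologicalSpace X] : Prop :=
  ∀ g : C(X, Circle), ∃ θ : C(X, ℝ), ∀ x, Circle.exp (θ x) = g x

/-- Uniqueness of lifts along the covering `Circle.exp`: after a shift by a constant in its kernel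
the two functions agree at `x`, hence everywhere. -/
lemma sub_eq_sub_of_circleExp_eq {X : Type*} [TopologicalSpace X] [PreconnectedSpace X]
    {θ θ' : X → ℝ} (hθ : Continuous θ) (hθ' : Continuous θ')
    (h : ∀ x, Circle.exp (θ x) = Circle.exp (θ' x)) (x y : X) :
    θ x - θ' x = θ y - θ' y := by
  have hx : Circle.exp (θ x - θ' x) = 1 := by rw [Circle.exp_sub, h, div_self']
  have := Circle.isCoveringMap_exp.eq_of_comp_eq hθ (hθ'.add_const (θ x - θ' x))
    (funext fun z => by
      simp only [Function.comp_apply]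
      rw [Circle.exp_add, hx, mul_one, h]) x (by ring)
  rw [congrFun this y]
  ring

/-- The constant map at time 0 has a constant argument, and homotopy lifting along `Circle.exp`
carries it to time 1. -/
lemma exists_arg_of_homotopy {X Z : Type*} [TopologicalSpace X] [TopologicalSpace Z]
    (H : C(unitInterval × X, Z)) (z : Z) (hH : ∀ x, H (0, x) = z) (g : C(Z, Circle)) :
    ∃ θ : C(X, ℝ), ∀ x, Circle.exp (θ x) = g (H (1, x)) := by
  obtain ⟨t, ht⟩ := Circle.exp_surjective (g z)
  have h0 : ∀ x, (g.comp H) (0, x) = Circle.exp (ContinuousMap.const X t x) := fun x => by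
    simp [hH, ht]
  refine ⟨(Circle.isCoveringMap_exp.liftHomotopy (g.comp H) (.const X t) h0).comp
    ⟨fun x => (1, x), by fun_prop⟩, fun x => ?_⟩
  exact congrFun (Circle.isCoveringMap_exp.liftHomotopy_lifts (g.comp H) (.const X t) h0) (1, x)

lemma exists_contraction (X : Type*) [TopologicalSpace X] [ContractibleSpace X] :
    ∃ (z : X) (H : C(unitInterval × X, X)), (∀ x, H (0, x) = z) ∧ ∀ x, H (1, x) = x := by
  obtain ⟨z, ⟨F⟩⟩ := id_nullhomotopic X
  exact ⟨z, F.symm.toContinuousMap, fun x => F.symm.apply_zero x, fun x => F.symm.apply_one x⟩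

lemma HasArg.of_contractible (X : Type*) [TopologicalSpace X] [ContractibleSpace X] :
    HasArg X := fun g => by
  obtain ⟨z, H, h0, h1⟩ := exists_contraction X
  obtain ⟨θ, hθ⟩ := exists_arg_of_homotopy H z h0 g
  exact ⟨θ, fun x => by rw [hθ, h1]⟩

/-- The argument can be prescribed at one point. -/
lemma HasArg.exists_eq {X : Type*} [TopologicalSpace X] (h : HasArg X) (g : C(X, Circle)) (x : X)
    {t : ℝ} (ht : Circle.exp t = g x) :
    ∃ θ : C(X, ℝ), (∀ y, Circle.exp (θ y) = g y) ∧ θ x = t := by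
  obtain ⟨θ, hθ⟩ := h g
  refine ⟨⟨fun y => θ y + (t - θ x), by fun_prop⟩, fun y => ?_, by simp⟩
  simp [Circle.exp_add, hθ, ht]

lemma HasArg.of_homeomorph {X X' : Type*} [TopologicalSpace X] [TopologicalSpace X']
    (e : X ≃ₜ X') (h : HasArg X) : HasArg X' := fun g => by
  obtain ⟨θ, hθ⟩ := h (g.comp e)
  exact ⟨θ.comp e.symm, fun x => by simp [hθ]⟩

/-! ### Gluing along two closed sets -/

lemma exists_glue {X Z : Type*} [TopologicalSpace X] [TopologicalSpace Z] {s t : Set X}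
    (hs : IsClosed s) (ht : IsClosed t) (hst : s ∪ t = Set.univ) (f : C(s, Z)) (g : C(t, Z))
    (hfg : ∀ x (hxs : x ∈ s) (hxt : x ∈ t), f ⟨x, hxs⟩ = g ⟨x, hxt⟩) :
    ∃ k : C(X, Z), (∀ x : s, k x = f x) ∧ ∀ x : t, k x = g x := by
  classical
  have hmem : ∀ x, x ∉ s → x ∈ t := fun x hx =>
    (hst.symm ▸ Set.mem_univ x : x ∈ s ∪ t).resolve_left hx
  let k : X → Z := fun x => if h : x ∈ s then f ⟨x, h⟩ else g ⟨x, hmem x h⟩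
  have ks : ∀ x : s, k x = f x := fun x => by simp [k]
  have kt : ∀ x : t, k x = g x := fun x => by
    by_cases h : (x : X) ∈ s
    · rw [← hfg x h x.2]
      simp [k, h]
    · simp [k, h]
  refine ⟨⟨k, ?_⟩, ks, kt⟩
  rw [← continuousOn_univ, ← hst]
  refine ContinuousOn.union_of_isClosed ?_ ?_ hs ht
  · rw [continuousOn_iff_continuous_domRestrict]
    exact f.continuous.congr fun x => (ks x).symm
  · rw [continuousOn_iff_continuous_domRestrict]
    exact g.continuous.congr fun x => (kt x).symm

/-- On the connected overlap the two arguments differ by a constant, a multiple of `2π`; shifting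
one of them by it makes them glue. -/
lemma exists_arg_of_closed_cover {X : Type*} [TopologicalSpace X] {s t : Set X}
    (hs : IsClosed s) (ht : IsClosed t) (hst : s ∪ t = Set.univ)
    (hc : IsConnected (s ∩ t)) (g : C(X, Circle))
    (hgs : ∃ θ : C(s, ℝ), ∀ x, Circle.exp (θ x) = g x)
    (hgt : ∃ θ : C(t, ℝ), ∀ x, Circle.exp (θ x) = g x) :
    ∃ θ : C(X, ℝ), ∀ x, Circle.exp (θ x) = g x := by
  obtain ⟨θ, hθ⟩ := hgs
  obtain ⟨θ', hθ'⟩ := hgt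
  obtain ⟨z, hz⟩ := hc.nonempty
  have : PreconnectedSpace ↥(s ∩ t) := isPreconnected_iff_preconnectedSpace.1 hc.isPreconnected
  have key := sub_eq_sub_of_circleExp_eq (X := ↥(s ∩ t)) (θ := fun x => θ ⟨x, x.2.1⟩)
    (θ' := fun x => θ' ⟨x, x.2.2⟩) (by fun_prop) (by fun_prop) (fun x => by rw [hθ, hθ'])
  let c : ℝ := θ ⟨z, hz.1⟩ - θ' ⟨z, hz.2⟩
  have hc1 : Circle.exp c = 1 := by simp [c, hθ, hθ']
  obtain ⟨k, k1, k2⟩ := exists_glue hs ht hst θ ⟨fun x => θ' x + c, by fun_prop⟩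
    (fun x hxs hxt => by
      have := key ⟨x, hxs, hxt⟩ ⟨z, hz⟩
      simp only [ContinuousMap.coe_mk, c]
      linarith)
  refine ⟨k, fun x => ?_⟩
  rcases (hst.symm ▸ Set.mem_univ x : x ∈ s ∪ t) with h | h
  · rw [k1 ⟨x, h⟩, hθ]
  · rw [k2 ⟨x, h⟩]
    simp [Circle.exp_add, hc1, hθ']

/-! ### Hemispheres -/

section Sphere

variable {E : Type*} [NormedAddCommGroup E] [InnerProductSpace ℝ E]

/-- The closed hemisphere of the unit sphere centred at `w`. -/
def hemisphere (w : E) : Set (Metric.sphere (0 : E) 1) := {x | 0 ≤ ⟪w, (x : E)⟫_ℝ}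

lemma isClosed_hemisphere (w : E) : IsClosed (hemisphere w) :=
  isClosed_le continuous_const (by fun_prop)

lemma hemisphere_union_neg (w : E) : hemisphere w ∪ hemisphere (-w) = Set.univ := by
  ext x
  simp only [hemisphere, inner_neg_left, Set.mem_union, Set.mem_ofPred_eq, Set.mem_univ, iff_true]
  rcases le_total 0 ⟪w, (x : E)⟫_ℝ with h | h
  · exact .inl h
  · exact .inr (by linarith)

lemma mem_hemisphere_inter_neg {w : E} {x : Metric.sphere (0 : E) 1} :
    x ∈ hemisphere w ∩ hemisphere (-w) ↔ ⟪w, (x : E)⟫_ℝ = 0 := by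
  simp only [hemisphere, inner_neg_left, Set.mem_inter_iff, Set.mem_ofPred_eq]
  constructor
  · rintro ⟨h, h'⟩
    linarith
  · intro h
    simp [h]

/-- The normalised straight-line homotopy from `w`. Pairing a zero of the segment with `w` forces `t
= 1`, because `⟪w, x⟫ ≥ 0`, and then `x = 0`. A contraction inside the whole sphere is enough, since
the maps and projections to be studied are defined there. -/
lemma exists_hemisphere_contraction (w : Metric.sphere (0 : E) 1) :
    ∃ H : C(unitInterval × hemisphere (w : E), Metric.sphere (0 : E) 1),
      (∀ x, H (0, x) = w) ∧ ∀ x, H (1, x) = x := by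
  let f : unitInterval × hemisphere (w : E) → E := fun q =>
    (1 - (q.1 : ℝ)) • (w : E) + (q.1 : ℝ) • (q.2 : E)
  have hw : ‖(w : E)‖ = 1 := by simp
  have hf : Continuous f := by fun_prop
  have hf0 : ∀ q, f q ≠ 0 := by
    rintro ⟨t, x⟩ h
    have hx : ‖((x : Metric.sphere (0 : E) 1) : E)‖ = 1 := by simp
    have h1 : (1 - (t : ℝ)) + t * ⟪(w : E), (x : E)⟫_ℝ = 0 := by
      have := congrArg (fun v => ⟪(w : E), v⟫_ℝ) h
      simpa [f, inner_add_right, inner_smul_right, real_inner_self_eq_norm_sq] using this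
    have h2 : 0 ≤ ⟪(w : E), (x : E)⟫_ℝ := x.2
    have h3 := t.2.1
    have h4 := t.2.2
    have h5 : (t : ℝ) = 1 := by nlinarith [mul_nonneg h3 h2]
    have h6 : (x : E) = 0 := by simpa [f, h5] using h
    rw [h6, norm_zero] at hx
    exact zero_ne_one hx
  refine ⟨⟨fun q => ⟨(‖f q‖)⁻¹ • f q, by
    simp [norm_smul, inv_mul_cancel₀ (norm_ne_zero_iff.2 (hf0 q))]⟩, ?_⟩, fun x => ?_, fun x => ?_⟩
  · exact Continuous.subtype_mk ((hf.norm.inv₀ fun q => norm_ne_zero_iff.2 (hf0 q)).smul hf) _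
  · ext
    simp [f]
  · ext
    simp [f]

/-- The equator orthogonal to `w` is the unit sphere of `wᗮ`. -/
def equatorHomeomorph (w : E) :
    Metric.sphere (0 : (ℝ ∙ w)ᗮ) 1 ≃ₜ ↥(hemisphere w ∩ hemisphere (-w)) where
  toFun x := ⟨⟨(x : (ℝ ∙ w)ᗮ), mem_sphere_zero_iff_norm.2 (mem_sphere_zero_iff_norm.1 x.2 :)⟩, mem_hemisphere_inter_neg.2
    ((Submodule.mem_orthogonal_singleton_iff_inner_right).1 (x : (ℝ ∙ w)ᗮ).2)⟩
  invFun x := ⟨⟨(x : Metric.sphere (0 : E) 1),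
    Submodule.mem_orthogonal_singleton_iff_inner_right.2 (mem_hemisphere_inter_neg.1 x.2)⟩, by
      simp⟩
  left_inv x := rfl
  right_inv x := rfl
  continuous_toFun := by fun_prop
  continuous_invFun := by fun_prop

lemma exists_arg_hemisphere (w : Metric.sphere (0 : E) 1)
    (g : C(Metric.sphere (0 : E) 1, Circle)) :
    ∃ θ : C(hemisphere (w : E), ℝ), ∀ x, Circle.exp (θ x) = g x := by
  obtain ⟨H, h0, h1⟩ := exists_hemisphere_contraction w
  obtain ⟨θ, hθ⟩ := exists_arg_of_homotopy H w h0 g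
  exact ⟨θ, fun x => by rw [hθ, h1]⟩

lemma finrank_orthogonal_span_unit [FiniteDimensional ℝ E] (w : Metric.sphere (0 : E) 1) :
    Module.finrank ℝ (ℝ ∙ (w : E))ᗮ + 1 = Module.finrank ℝ E := by
  rw [← (ℝ ∙ (w : E)).finrank_add_finrank_orthogonal,
    finrank_span_singleton (Metric.ne_of_mem_sphere w.2 one_ne_zero), add_comm]

lemma isConnected_equator [FiniteDimensional ℝ E] (hE : 2 < Module.finrank ℝ E)
    (w : Metric.sphere (0 : E) 1) : IsConnected (hemisphere (w : E) ∩ hemisphere (-(w : E))) := by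
  have h := finrank_orthogonal_span_unit w
  have hc : IsConnected (Metric.sphere (0 : (ℝ ∙ (w : E))ᗮ) 1) :=
    isConnected_sphere (by rw [← Module.finrank_eq_rank]; exact_mod_cast by omega) 0 zero_le_one
  have := isConnected_iff_connectedSpace.1 hc
  exact isConnected_iff_connectedSpace.2
    ((equatorHomeomorph (w : E)).surjective.connectedSpace (equatorHomeomorph (w : E)).continuous)

theorem HasArg.sphere [FiniteDimensional ℝ E] (hE : 2 < Module.finrank ℝ E) :
    HasArg (Metric.sphere (0 : E) 1) := fun g => by
  have : Nontrivial E := Module.nontrivial_of_finrank_pos (R := ℝ) (by omega)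
  obtain ⟨w⟩ : Nonempty (Metric.sphere (0 : E) 1) :=
    (NormedSpace.sphere_nonempty.2 zero_le_one).to_subtype
  exact exists_arg_of_closed_cover (isClosed_hemisphere (w : E)) (isClosed_hemisphere (-(w : E)))
    (hemisphere_union_neg _) (isConnected_equator hE w) g (exists_arg_hemisphere w g)
    (exists_arg_hemisphere (-w) g)

end Sphere

/-! ### Polar decomposition of nowhere vanishing complex functions -/

/-- The direction `c / |c|` of a nowhere vanishing complex function. -/
noncomputable def circleDirection {X : Type*} [TopologicalSpace X] (c : C(X, ℂ)) (hc : ∀ x, c x ≠ 0) :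
    C(X, Circle) where
  toFun x := ⟨c x / ‖c x‖, mem_sphere_zero_iff_norm.2 (by simp [hc x])⟩
  continuous_toFun := Continuous.subtype_mk (c.continuous.div (by fun_prop) fun x => by
    simpa using hc x) _

lemma norm_mul_circleDirection {X : Type*} [TopologicalSpace X] (c : C(X, ℂ))
    (hc : ∀ x, c x ≠ 0) (x : X) : (‖c x‖ : ℂ) * circleDirection c hc x = c x :=
  mul_div_cancel₀ _ (by simpa using hc x)

lemma HasArg.exists_log {X : Type*} [TopologicalSpace X] (h : HasArg X) (c : C(X, ℂ))
    (hc : ∀ x, c x ≠ 0) : ∃ l : C(X, ℂ), ∀ x, Complex.exp (l x) = c x := by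
  obtain ⟨θ, hθ⟩ := h (circleDirection c hc)
  refine ⟨⟨fun x => (Real.log ‖c x‖ : ℝ) + (θ x : ℂ) * Complex.I, ?_⟩, fun x => ?_⟩
  · have : Continuous fun x => Real.log ‖c x‖ :=
      Continuous.log (by fun_prop) fun x => norm_ne_zero_iff.2 (hc x)
    fun_prop
  · rw [ContinuousMap.coe_mk, Complex.exp_add, ← Circle.coe_exp, hθ, ← Complex.ofReal_exp,
      Real.exp_log (norm_pos_iff.2 (hc x)), norm_mul_circleDirection]

/-! ### Sections of line bundles over spheres -/

section Sections

variable {V : Type*} [NormedAddCommGroup V] [InnerProductSpace ℂ V]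

/-- Along a fine enough subdivision of time, consecutive projections differ by less than 1 in norm.
Applying the next projection to the current section then cannot kill it, so the constant section at
time 0 can be pushed step by step to time 1. -/
lemma exists_section_of_homotopy {X Z : Type*} [MetricSpace X] [CompactSpace X]
    [TopologicalSpace Z] (H : C(unitInterval × X, Z)) (z : Z) (hH : ∀ x, H (0, x) = z)
    (P : C(Z, V →L[ℂ] V)) (hP : ∀ z v, P z (P z v) = P z v) (hz : ∃ v, P z v ≠ 0) :
    ∃ s : C(X, V), ∀ x, s x ≠ 0 ∧ P (H (1, x)) (s x) = s x := by
  have huc := CompactSpace.uniformContinuous_of_continuous (P.comp H).continuous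
  obtain ⟨δ, hδ, hd⟩ := Metric.uniformContinuous_iff.1 huc 1 one_pos
  obtain ⟨N, hN⟩ := exists_nat_one_div_lt hδ
  let τ : ℕ → unitInterval := fun k => Set.projIcc 0 1 zero_le_one ((k : ℝ) * (1 / ((N : ℝ) + 1)))
  have hτ : ∀ k, dist (τ (k + 1)) (τ k) < δ := fun k => by
    refine lt_of_le_of_lt (b := dist (((k + 1 : ℕ) : ℝ) * (1 / ((N : ℝ) + 1)))
      ((k : ℝ) * (1 / ((N : ℝ) + 1)))) ?_ ?_
    · exact (LipschitzWith.projIcc zero_le_one).dist_le_mul _ _ |>.trans (by simp)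
    · rw [Real.dist_eq, ← sub_mul]
      push_cast
      rw [add_sub_cancel_left, one_mul, abs_of_pos (by positivity)]
      exact hN
  have key : ∀ k, ∃ s : C(X, V), ∀ x, s x ≠ 0 ∧ P (H (τ k, x)) (s x) = s x := by
    intro k
    induction k with
    | zero =>
      obtain ⟨v, hv⟩ := hz
      have h0 : τ 0 = 0 := by simp [τ]
      exact ⟨.const X (P z v), fun x => ⟨hv, by simp [h0, hH, hP]⟩⟩
    | succ k ih =>
      obtain ⟨s, hs⟩ := ih
      refine ⟨⟨fun x => P (H (τ (k + 1), x)) (s x), by fun_prop⟩, fun x => ⟨?_, hP _ _⟩⟩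
      have h1 : ‖P (H (τ (k + 1), x)) - P (H (τ k, x))‖ < 1 := by
        rw [← dist_eq_norm]
        refine hd (a := (τ (k + 1), x)) (b := (τ k, x)) ?_
        rw [Prod.dist_eq, dist_self, max_eq_left dist_nonneg]
        exact hτ k
      -- If the new projection killed `s x`, then `‖s x‖` would be the norm of the difference of the
      -- projections at `s x`, which is smaller than `‖s x‖`.
      intro h2
      have h3 := (P (H (τ (k + 1), x)) - P (H (τ k, x))).le_opNorm (s x)
      have h4 : P (H (τ (k + 1), x)) (s x) = 0 := h2
      rw [sub_apply, h4, (hs x).2, zero_sub, norm_neg] at h3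
      have h5 : 0 < ‖s x‖ := norm_pos_iff.2 (hs x).1
      nlinarith
  obtain ⟨s, hs⟩ := key (N + 1)
  have h1 : τ (N + 1) = 1 := by
    have : ((N + 1 : ℕ) : ℝ) * (1 / ((N : ℝ) + 1)) = 1 := by
      push_cast
      field_simp
    simp only [τ, this]
    exact Set.projIcc_right zero_le_one
  exact ⟨s, fun x => by simpa only [h1] using hs x⟩

/-- On the overlap the two sections span the same lines, so their ratio is a nowhere zero function
`c`. A logarithm of `c` turns the gluing problem into one of extending a complex-valued function. -/
lemma exists_section_of_closed_cover {X : Type*} [TopologicalSpace X] [NormalSpace X]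
    {s t : Set X} (hs : IsClosed s) (ht : IsClosed t) (hst : s ∪ t = Set.univ)
    (harg : HasArg ↥(s ∩ t)) (P : C(X, V →L[ℂ] V))
    (hP : ∀ x, ∃ e : V, ∀ v, P x v = ⟪e, v⟫_ℂ • e)
    (hPs : ∃ f : C(s, V), ∀ x, f x ≠ 0 ∧ P x (f x) = f x)
    (hPt : ∃ f : C(t, V), ∀ x, f x ≠ 0 ∧ P x (f x) = f x) :
    ∃ f : C(X, V), ∀ x, f x ≠ 0 ∧ P x (f x) = f x := by
  obtain ⟨f, hf⟩ := hPs
  obtain ⟨g, hg⟩ := hPt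
  let f' : C(↥(s ∩ t), V) := ⟨fun x => f ⟨x, x.2.1⟩, by fun_prop⟩
  let g' : C(↥(s ∩ t), V) := ⟨fun x => g ⟨x, x.2.2⟩, by fun_prop⟩
  have hf' : ∀ x, f' x ≠ 0 ∧ P x (f' x) = f' x := fun x => hf ⟨x, x.2.1⟩
  have hg' : ∀ x, g' x ≠ 0 ∧ P x (g' x) = g' x := fun x => hg ⟨x, x.2.2⟩
  have hgg : ∀ x, ⟪g' x, g' x⟫_ℂ ≠ 0 := fun x => inner_self_ne_zero.2 (hg' x).1
  let c : C(↥(s ∩ t), ℂ) := ⟨fun x => ⟪g' x, f' x⟫_ℂ / ⟪g' x, g' x⟫_ℂ,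
    Continuous.div (by fun_prop) (by fun_prop) hgg⟩
  have hc : ∀ x, f' x = c x • g' x := fun x => by
    obtain ⟨e, he⟩ := hP x
    have h1 := (hf' x).2
    have h2 := (hg' x).2
    rw [he] at h1 h2
    have h3 : ∃ a b : ℂ, f' x = a • e ∧ g' x = b • e := ⟨_, _, h1.symm, h2.symm⟩
    obtain ⟨a, b, ha, hb⟩ := h3
    have h4 := hgg x
    simp only [c, ContinuousMap.coe_mk]
    rw [hb, inner_smul_left, inner_smul_right] at h4
    rw [ha, hb, inner_smul_left, inner_smul_right, inner_smul_left, inner_smul_right, smul_smul]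
    congr 1
    simp only [mul_ne_zero_iff] at h4
    obtain ⟨h4, h5, h6⟩ := h4
    field_simp
  have hc0 : ∀ x, c x ≠ 0 := fun x h => (hf' x).1 (by rw [hc, h, zero_smul])
  obtain ⟨l, hl⟩ := harg.exists_log c hc0
  -- Tietze extension is applied to the logarithm and not to `c`, so that the extended factor `exp
  -- L` stays nonzero.
  obtain ⟨L, hL⟩ := l.exists_restrict_eq (hs.inter ht)
  have hL' : ∀ x : ↥(s ∩ t), L x = l x := fun x => DFunLike.congr_fun hL x
  obtain ⟨k, k1, k2⟩ := exists_glue hs ht hst f ⟨fun x => Complex.exp (L x) • g x, by fun_prop⟩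
    (fun x hxs hxt => by
      have := hc ⟨x, hxs, hxt⟩
      rw [← hl, ← hL'] at this
      exact this)
  refine ⟨k, fun x => ?_⟩
  rcases (hst.symm ▸ Set.mem_univ x : x ∈ s ∪ t) with h | h
  · rw [k1 ⟨x, h⟩]
    exact hf ⟨x, h⟩
  · rw [k2 ⟨x, h⟩]
    refine ⟨smul_ne_zero (Complex.exp_ne_zero _) (hg _).1, ?_⟩
    simp only [ContinuousMap.coe_mk, map_smul]
    rw [(hg ⟨x, h⟩).2]

/-- A continuous family of rank one projections over a sphere of dimension at least two has a
nowhere vanishing section. -/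
theorem exists_section_sphere {E : Type*} [NormedAddCommGroup E] [InnerProductSpace ℝ E]
    [FiniteDimensional ℝ E] (hE : 3 < Module.finrank ℝ E)
    (P : C(Metric.sphere (0 : E) 1, V →L[ℂ] V))
    (hP : ∀ x, ∃ e : V, ‖e‖ = 1 ∧ ∀ v, P x v = ⟪e, v⟫_ℂ • e) :
    ∃ f : C(Metric.sphere (0 : E) 1, V), ∀ x, f x ≠ 0 ∧ P x (f x) = f x := by
  have : Nontrivial E := Module.nontrivial_of_finrank_pos (R := ℝ) (by omega)
  obtain ⟨w⟩ : Nonempty (Metric.sphere (0 : E) 1) :=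
    (NormedSpace.sphere_nonempty.2 zero_le_one).to_subtype
  have hPP : ∀ z v, P z (P z v) = P z v := fun z v => by
    obtain ⟨e, he, h⟩ := hP z
    rw [h, h, inner_smul_right, inner_self_eq_norm_sq_to_K, he]
    simp
  have hP0 : ∀ z, ∃ v, P z v ≠ 0 := fun z => by
    obtain ⟨e, he, h⟩ := hP z
    have he0 : e ≠ 0 := norm_ne_zero_iff.1 (he ▸ one_ne_zero)
    exact ⟨e, by rw [h]; exact smul_ne_zero (inner_self_ne_zero.2 he0) he0⟩
  have hhem : ∀ w : Metric.sphere (0 : E) 1, ∃ f : C(hemisphere (w : E), V),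
      ∀ x, f x ≠ 0 ∧ P x (f x) = f x := fun w => by
    obtain ⟨H, h0, h1⟩ := exists_hemisphere_contraction w
    have : CompactSpace (hemisphere (w : E)) :=
      isCompact_iff_compactSpace.1 (isClosed_hemisphere (w : E)).isCompact
    obtain ⟨f, hf⟩ := exists_section_of_homotopy H w h0 P hPP (hP0 w)
    exact ⟨f, fun x => h1 x ▸ hf x⟩
  refine exists_section_of_closed_cover (isClosed_hemisphere (w : E))
    (isClosed_hemisphere (-(w : E))) (hemisphere_union_neg _) ?_ P
    (fun x => (hP x).imp fun _ h => h.2) (hhem w) (hhem (-w))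
  -- The equator is the unit sphere of a space of dimension at least three, as `HasArg.sphere`
  -- requires; this is where `3 < finrank` is used, so the sphere itself has dimension at least
  -- three.
  have h := finrank_orthogonal_span_unit w
  exact (HasArg.sphere (by omega)).of_homeomorph (equatorHomeomorph (w : E))

end Sections

/-! ### Singular simplices and cocycles of degree one -/

namespace Singular

open SimplicialCohomology Opposite

/-- The standard topological `n`-simplex. -/
abbrev Simplex (n : ℕ) : Type := stdSimplex ℝ (Fin (n + 1))

/-- The `i`-th vertex of the standard simplex. -/
abbrev vert {n : ℕ} (i : Fin (n + 1)) : Simplex n := stdSimplex.vertex i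

instance (n : ℕ) : ContractibleSpace (Simplex n) :=
  (convex_stdSimplex ℝ _).contractibleSpace ⟨_, (vert (0 : Fin (n + 1))).2⟩

/-- The map of standard simplices induced by a map of vertices. -/
noncomputable def simplexMap {m n : ℕ} (f : Fin (m + 1) → Fin (n + 1)) : C(Simplex m, Simplex n) :=
  ⟨stdSimplex.map f, stdSimplex.continuous_map f⟩

@[simp]
lemma simplexMap_vert {m n : ℕ} (f : Fin (m + 1) → Fin (n + 1)) (i : Fin (m + 1)) :
    simplexMap f (vert i) = vert (f i) :=
  stdSimplex.map_vertex f i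

variable {Y : Type} [TopologicalSpace Y]

section

open scoped Simplicial

/-- The singular simplex given by a continuous map. -/
noncomputable def ofMap {n : ℕ} (f : C(Simplex n, Y)) :
    (TopCat.toSSet.obj (TopCat.of Y)) _⦋n⦌ :=
  (TopCat.toSSetObjEquiv (TopCat.of Y) (op ⦋n⦌)).symm f

lemma exists_ofMap {n : ℕ} (x : (TopCat.toSSet.obj (TopCat.of Y)) _⦋n⦌) :
    ∃ f : C(Simplex n, Y), x = ofMap f :=
  ⟨TopCat.toSSetObjEquiv (TopCat.of Y) (op ⦋n⦌) x, (Equiv.symm_apply_apply _ _).symm⟩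

lemma map_ofMap {m n : ℕ} (g : ⦋m⦌ ⟶ ⦋n⦌) (f : C(Simplex n, Y)) :
    (TopCat.toSSet.obj (TopCat.of Y)).map g.op (ofMap f) =
      ofMap (f.comp (simplexMap g.toOrderHom)) := rfl

lemma δ_ofMap {n : ℕ} (i : Fin (n + 2)) (f : C(Simplex (n + 1), Y)) :
    (TopCat.toSSet.obj (TopCat.of Y)).δ i (ofMap f) =
      ofMap (f.comp (simplexMap i.succAbove)) := rfl

end

/-- Integral singular cochains. -/
abbrev SingularCochain (Y : Type) [TopologicalSpace Y] (n : ℕ) : Type :=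
  Cochain (TopCat.toSSet.obj (TopCat.of Y)) n

lemma coboundary_one_ofMap (φ : SingularCochain Y 1) (τ : C(Simplex 2, Y)) :
    coboundary _ 1 φ (ofMap τ) =
      φ (ofMap (τ.comp (simplexMap ![1, 2]))) - φ (ofMap (τ.comp (simplexMap ![0, 2]))) +
        φ (ofMap (τ.comp (simplexMap ![0, 1]))) := by
  have h0 : (0 : Fin 3).succAbove = ![1, 2] := by decide
  have h1 : (1 : Fin 3).succAbove = ![0, 2] := by decide
  have h2 : (2 : Fin 3).succAbove = ![0, 1] := by decide
  simp only [coboundary, AddMonoidHom.coe_mk, ZeroHom.coe_mk]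
  rw [Fin.sum_univ_three, δ_ofMap, δ_ofMap, δ_ofMap, h0, h1, h2]
  simp
  ring

lemma cocycle_triangle {φ : SingularCochain Y 1} (hφ : φ ∈ cocycles _ 1) (τ : C(Simplex 2, Y)) :
    φ (ofMap (τ.comp (simplexMap ![0, 1]))) + φ (ofMap (τ.comp (simplexMap ![1, 2]))) =
      φ (ofMap (τ.comp (simplexMap ![0, 2]))) := by
  have h : coboundary _ 1 φ = 0 := hφ
  have h' := congrFun h (ofMap τ)
  rw [coboundary_one_ofMap] at h'
  simp only [Pi.zero_apply] at h'
  linarith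

/-- The constant triangle gives `c + c = c`. -/
lemma cocycle_const {φ : SingularCochain Y 1} (hφ : φ ∈ cocycles _ 1) (y : Y) :
    φ (ofMap (.const _ y)) = 0 := by
  have := cocycle_triangle hφ (.const _ y)
  simpa using this

/-! ### Affine simplices in a convex set, and primitives of cocycles on contractible pieces -/

section Affine

variable {E : Type*} [AddCommGroup E] [Module ℝ E] [TopologicalSpace E] [IsTopologicalAddGroup E]
  [ContinuousSMul ℝ E] {s : Set E}

/-- The affine singular simplex with given vertices in a convex set. -/
noncomputable def affineSimplex (hs : Convex ℝ s) {n : ℕ} (v : Fin (n + 1) → s) :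
    C(Simplex n, s) where
  toFun x := ⟨∑ i, x i • (v i : E),
    hs.sum_mem (fun i _ => x.2.1 i) x.2.2 fun i _ => (v i).2⟩
  continuous_toFun := by
    refine Continuous.subtype_mk (continuous_finsetSum _ fun i _ => ?_) _
    exact ((continuous_apply i).comp continuous_subtype_val).smul continuous_const

lemma affineSimplex_comp_simplexMap (hs : Convex ℝ s) {m n : ℕ} (v : Fin (n + 1) → s)
    (f : Fin (m + 1) → Fin (n + 1)) :
    (affineSimplex hs v).comp (simplexMap f) = affineSimplex hs (v ∘ f) := by
  ext x
  change ∑ i, (FunOnFinite.linearMap ℝ ℝ f x) i • (v i : E) = ∑ j, x j • (v (f j) : E)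
  simp only [FunOnFinite.linearMap_apply_apply, Finset.sum_smul]
  rw [← Finset.sum_fiberwise Finset.univ f]
  refine Finset.sum_congr rfl fun i _ => Finset.sum_congr rfl fun j hj => ?_
  rw [(Finset.mem_filter.1 hj).2]

lemma cocycle_affine_add {φ : SingularCochain Y 1} (hφ : φ ∈ cocycles _ 1) (hs : Convex ℝ s)
    (γ : C(s, Y)) (u v w : s) :
    φ (ofMap (γ.comp (affineSimplex hs ![u, v]))) + φ (ofMap (γ.comp (affineSimplex hs ![v, w]))) =
      φ (ofMap (γ.comp (affineSimplex hs ![u, w]))) := by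
  have := cocycle_triangle hφ (γ.comp (affineSimplex hs ![u, v, w]))
  simp only [ContinuousMap.comp_assoc, affineSimplex_comp_simplexMap] at this
  have h1 : ![u, v, w] ∘ ![0, 1] = ![u, v] := by ext i; fin_cases i <;> rfl
  have h2 : ![u, v, w] ∘ ![1, 2] = ![v, w] := by ext i; fin_cases i <;> rfl
  have h3 : ![u, v, w] ∘ ![0, 2] = ![u, w] := by ext i; fin_cases i <;> rfl
  rwa [h1, h2, h3] at this

end Affine

lemma sum_smul_vert {n : ℕ} (x : Simplex n) :
    ∑ i, x i • ((vert i : Simplex n) : Fin (n + 1) → ℝ) = x := by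
  ext j
  simp [Finset.sum_apply, Pi.single_apply]

/-- A potential of a `1`-cochain on the `1`-simplices contained in a set. -/
def HasPotential (φ : SingularCochain Y 1) (N : Set Y) : Prop :=
  ∃ f : Y → ℤ, ∀ σ : C(Simplex 1, Y), (∀ x, σ x ∈ N) →
    φ (ofMap σ) = f (σ (vert 1)) - f (σ (vert 0))

/-- A cocycle has a potential on a disjoint union of contractible open pieces. -/
lemma hasPotential_of_homeomorph {φ : SingularCochain Y 1} (hφ : φ ∈ cocycles _ 1) {N : Set Y}
    {C F : Type*} [TopologicalSpace C] [ContractibleSpace C] [TopologicalSpace F]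
    [DiscreteTopology F] (e : N ≃ₜ C × F) : HasPotential φ N := by
  classical
  obtain ⟨c, H, h0, h1⟩ := exists_contraction C
  have hc : ∀ y : N, Continuous fun x : Simplex 1 =>
      (e.symm (H (stdSimplexHomeomorphUnitInterval x, (e y).1), (e y).2) : Y) := fun y => by
    fun_prop
  -- The potential at `y` is the value of `φ` on the contraction path from the centre of the piece
  -- to `y`; the value 0 outside `N` is never used.
  let f : Y → ℤ := fun y => if h : y ∈ N then φ (ofMap ⟨_, hc ⟨y, h⟩⟩) else 0
  refine ⟨f, fun σ hσ => ?_⟩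
  -- `γ` sweeps `σ` along the contraction, over the rectangle `s`. Its top edge is `σ`, its bottom
  -- edge is constant, and its vertical edges are the paths that define `f` at the ends of `σ`.
  let s : Set ((Fin 2 → ℝ) × ℝ) := stdSimplex ℝ (Fin 2) ×ˢ Set.Icc 0 1
  have hs : Convex ℝ s := (convex_stdSimplex ℝ _).prod (convex_Icc 0 1)
  let σ' : C(Simplex 1, N) := ⟨fun x => ⟨σ x, hσ x⟩, by fun_prop⟩
  let γ : C(s, Y) := ⟨fun q => e.symm (H (⟨q.1.2, q.2.2⟩, (e (σ' ⟨q.1.1, q.2.1⟩)).1),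
    (e (σ' ⟨q.1.1, q.2.1⟩)).2), by fun_prop⟩
  let q : Fin 2 → unitInterval → s := fun i t => ⟨(vert i, t), (vert i).2, t.2⟩
  have hq : ∀ (x : Simplex 1) (i j : Fin 2) (t t' : unitInterval),
      ((affineSimplex hs ![q i t, q j t'] x : s) : (Fin 2 → ℝ) × ℝ) =
        x 0 • ((vert i : Simplex 1).1, (t : ℝ)) + x 1 • ((vert j : Simplex 1).1, (t' : ℝ)) :=
    fun x i j t t' => by
      change ∑ k, x k • ((![q i t, q j t'] k : s) : (Fin 2 → ℝ) × ℝ) = _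
      rw [Fin.sum_univ_two]
      rfl
  have hhor : ∀ (x : Simplex 1) (t : unitInterval), affineSimplex hs ![q 0 t, q 1 t] x =
      (⟨(x, t), x.2, t.2⟩ : s) := fun x t => by
    have hx := sum_smul_vert x
    rw [Fin.sum_univ_two] at hx
    refine Subtype.ext ((hq x 0 1 t t).trans (Prod.ext hx ?_))
    change x 0 * (t : ℝ) + x 1 * (t : ℝ) = t
    rw [← add_mul, stdSimplex.add_eq_one, one_mul]
  have hver : ∀ (x : Simplex 1) (i : Fin 2), affineSimplex hs ![q i 0, q i 1] x =
      (⟨((vert i : Simplex 1), stdSimplexHomeomorphUnitInterval x), (vert i).2,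
        (stdSimplexHomeomorphUnitInterval x).2⟩ : s) := fun x i => by
    refine Subtype.ext ((hq x i i 0 1).trans (Prod.ext ?_ ?_))
    · change x 0 • (vert i : Simplex 1).1 + x 1 • (vert i : Simplex 1).1 = (vert i : Simplex 1).1
      rw [← add_smul, stdSimplex.add_eq_one, one_smul]
    · change x 0 * 0 + x 1 * 1 = x 1
      ring
  have hside : ∀ i, φ (ofMap (γ.comp (affineSimplex hs ![q i 0, q i 1]))) = f (σ (vert i)) := by
    intro i
    simp only [f, dif_pos (hσ (vert i))]
    congr 2
    ext x
    rw [ContinuousMap.comp_apply, hver]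
    rfl
  have htop : φ (ofMap (γ.comp (affineSimplex hs ![q 0 1, q 1 1]))) = φ (ofMap σ) := by
    congr 2
    ext x
    rw [ContinuousMap.comp_apply, hhor]
    change (e.symm (H (1, (e (σ' x)).1), (e (σ' x)).2) : Y) = σ x
    rw [h1, Prod.mk.eta, e.symm_apply_apply]
    rfl
  have hbot : φ (ofMap (γ.comp (affineSimplex hs ![q 0 0, q 1 0]))) = 0 := by
    rw [← cocycle_const hφ (e.symm (c, (e (σ' (vert 0))).2))]
    congr 2
    ext x
    rw [ContinuousMap.comp_apply, hhor]
    change (e.symm (H (0, (e (σ' x)).1), (e (σ' x)).2) : Y) = _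
    -- A path stays in one sheet, because the sheet label is a continuous map to a discrete space.
    rw [h0, PreconnectedSpace.constant (f := fun x => (e (σ' x)).2) inferInstance (by fun_prop)
      (x := x) (y := vert 0)]
    rfl
  -- The two triangles of the rectangle share the diagonal from `q 0 0` to `q 1 1`; equating its two
  -- values gives the claim.
  have k1 := cocycle_affine_add hφ hs γ (q 0 0) (q 0 1) (q 1 1)
  have k2 := cocycle_affine_add hφ hs γ (q 0 0) (q 1 0) (q 1 1)
  rw [hside, htop] at k1
  rw [hside, hbot] at k2
  linarith

end Singular

/-! ### Circle-valued maps representing cohomology classes of degree one -/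

namespace Singular

open SimplicialCohomology Opposite

variable {Y : Type} [TopologicalSpace Y]

/-- The circle-valued map `a`, with the (discontinuous) argument `A`, represents the integral
`1`-cochain `φ`: the increment of any continuous argument of `a` along a `1`-simplex is the
increment of `A` plus `2π` times the value of `φ`. -/
structure Represents (a : C(Y, Circle)) (A : Y → ℝ) (φ : SingularCochain Y 1) : Prop where
  exp_arg : ∀ y, Circle.exp (A y) = a y
  increment : ∀ (σ : C(Simplex 1, Y)) (θ : C(Simplex 1, ℝ)),
    (∀ x, Circle.exp (θ x) = a (σ x)) →
      θ (vert 1) - θ (vert 0) = A (σ (vert 1)) - A (σ (vert 0)) + 2 * Real.pi * φ (ofMap σ)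

/-- Multiplying by `exp r` does not change the represented cochain. -/
lemma Represents.mul_exp {a : C(Y, Circle)} {A : Y → ℝ} {φ : SingularCochain Y 1}
    (h : Represents a A φ) (r : C(Y, ℝ)) :
    Represents (a * Circle.exp.comp r) (A + r) φ where
  exp_arg y := by simp [Circle.exp_add, h.exp_arg]
  increment σ θ hθ := by
    have := h.increment σ (θ - r.comp σ) fun x => by simp [hθ]
    simp only [ContinuousMap.coe_sub, ContinuousMap.coe_comp, Pi.sub_apply,
      Function.comp_apply, Pi.add_apply] at this ⊢
    linarith

lemma circleExp_add_two_pi_mul_int (x : ℝ) (n : ℤ) :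
    Circle.exp (x + 2 * Real.pi * n) = Circle.exp x := by
  rw [Circle.exp_add, Circle.exp_two_pi_mul_int, mul_one]

/-- A function that locally differs from `-2π` times a potential of the cocycle `φ` by a
continuous function is an argument of a circle-valued map representing `φ`. -/
lemma exists_represents_of_potentials {φ : SingularCochain Y 1} (hφ : φ ∈ cocycles _ 1)
    (A : Y → ℝ) (hA : ∀ y, ∃ N : Set Y, IsOpen N ∧ y ∈ N ∧ ∃ f : Y → ℤ,
      (∀ σ : C(Simplex 1, Y), (∀ x, σ x ∈ N) →
        φ (ofMap σ) = f (σ (vert 1)) - f (σ (vert 0))) ∧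
      ContinuousAt (fun y => A y + 2 * Real.pi * f y) y) :
    ∃ a : C(Y, Circle), Represents a A φ := by
  have ha : Continuous fun y => Circle.exp (A y) := by
    rw [continuous_iff_continuousAt]
    intro y
    obtain ⟨N, -, -, f, -, hf⟩ := hA y
    refine (Circle.exp.continuous.continuousAt.comp hf).congr (.of_forall fun z => ?_)
    exact circleExp_add_two_pi_mul_int _ _
  refine ⟨⟨_, ha⟩, fun y => rfl, fun σ θ hθ => ?_⟩
  let s := stdSimplex ℝ (Fin 2)
  have hs : Convex ℝ s := convex_stdSimplex ℝ _
  -- `F u v` is the value of `φ` on the part of `σ` from `u` to `v`.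
  let F : Simplex 1 → Simplex 1 → ℤ := fun u v => φ (ofMap (σ.comp (affineSimplex hs ![u, v])))
  have hF : ∀ u v w, F u v + F v w = F u w := cocycle_affine_add hφ hs σ
  have hval : ∀ (u v x : Simplex 1), ((affineSimplex hs ![u, v] x : s) : Fin 2 → ℝ) =
      x 0 • u.1 + x 1 • v.1 := fun u v x => by
    change ∑ k, x k • ((![u, v] k : s) : Fin 2 → ℝ) = _
    rw [Fin.sum_univ_two]
    rfl
  have hF01 : F (vert 0) (vert 1) = φ (ofMap σ) := by
    simp only [F]
    congr 2
    ext x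
    have hx := sum_smul_vert x
    rw [Fin.sum_univ_two] at hx
    rw [ContinuousMap.comp_apply]
    exact congrArg σ (Subtype.ext ((hval _ _ x).trans hx))
  -- Near `x`, `F (vert 0)` and `f ∘ σ` differ by a constant, so the jumps of `A` are cancelled.
  -- This is therefore a continuous argument of `a ∘ σ`, to be compared with `θ`.
  have hcont : Continuous fun x => A (σ x) + 2 * Real.pi * F (vert 0) x := by
    rw [continuous_iff_continuousAt]
    intro x
    obtain ⟨N, hN, hxN, f, hf, hfc⟩ := hA (σ x)
    obtain ⟨ε, hε, hball⟩ := Metric.isOpen_iff.1 (hN.preimage σ.continuous) x hxN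
    have h1 : ContinuousAt (fun x' => A (σ x') + 2 * Real.pi * f (σ x') +
        2 * Real.pi * (F (vert 0) x - f (σ x))) x :=
      (hfc.comp (f := σ) σ.continuous.continuousAt).add continuousAt_const
    refine h1.congr ?_
    filter_upwards [Metric.ball_mem_nhds x hε] with x' hx'
    have h2 : F x x' = f (σ x') - f (σ x) := by
      have hend : ∀ i : Fin 2, affineSimplex hs ![x, x'] (vert i) = (![x, x'] i : s) := fun i => by
        refine Subtype.ext ((hval _ _ _).trans ?_)
        fin_cases i <;> simp
      have := hf (σ.comp (affineSimplex hs ![x, x'])) fun z => hball (by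
        have hb : Convex ℝ (Metric.ball x.1 ε) := convex_ball _ _
        change dist (affineSimplex hs ![x, x'] z).1 x.1 < ε
        rw [show (affineSimplex hs ![x, x'] z).1 = _ from hval x x' z]
        exact hb (Metric.mem_ball_self hε) hx' (z.2.1 0) (z.2.1 1) (stdSimplex.add_eq_one z))
      rw [ContinuousMap.comp_apply, ContinuousMap.comp_apply, hend, hend] at this
      exact this
    rw [← hF (vert 0) x x', h2]
    push_cast
    ring
  have h00 : F (vert 0) (vert 0) = 0 := by simpa using hF (vert 0) (vert 0) (vert 0)
  have := sub_eq_sub_of_circleExp_eq θ.continuous hcont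
    (fun x => by rw [hθ, circleExp_add_two_pi_mul_int]; rfl) (vert 1) (vert 0)
  rw [h00, hF01] at this
  push_cast at this
  linarith

/-- Over a compact Hausdorff base, a cocycle with potentials locally over the base is represented
by a circle-valued map. -/
theorem exists_represents {B : Type*} [TopologicalSpace B] [CompactSpace B] [T2Space B]
    [LocallyPathConnectedSpace Y] (p : C(Y, B)) {φ : SingularCochain Y 1} (hφ : φ ∈ cocycles _ 1)
    (hp : ∀ x, ∃ U : Set B, IsOpen U ∧ x ∈ U ∧ HasPotential φ (p ⁻¹' U)) :
    ∃ (a : C(Y, Circle)) (A : Y → ℝ), Represents a A φ := by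
  choose U hU hxU f hf using hp
  obtain ⟨t, ht⟩ := CompactSpace.elim_nhds_subcover U fun x => (hU x).mem_nhds (hxU x)
  obtain ⟨ρ, hρ⟩ := PartitionOfUnity.exists_isSubordinate (ι := t) isClosed_univ (fun i => U i)
    (fun i => hU i) (by
      rw [← Set.top_eq_univ, ← ht]
      exact Set.iUnion₂_subset fun x hx => Set.subset_iUnion (fun i : t => U i) ⟨x, hx⟩)
  -- Averaging the local potentials with a partition of unity: as `ρ` sums to 1, adding `2π f (p y)`
  -- leaves a weighted sum of differences of potentials.
  let A : Y → ℝ := fun y => -(2 * Real.pi) * ∑ i : t, ρ i (p y) * f i y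
  refine ⟨_, A, (exists_represents_of_potentials hφ A fun y => ?_).choose_spec⟩
  refine ⟨_, (hU (p y)).preimage p.continuous, hxU _, f (p y), hf _, ?_⟩
  have hsum : ∀ z, ∑ i : t, ρ i (p z) = 1 := fun z => by
    rw [← finsum_eq_sum_of_fintype]
    exact ρ.sum_eq_one (Set.mem_univ _)
  have hA : (fun z => A z + 2 * Real.pi * f (p y) z) = fun z =>
      2 * Real.pi * ∑ i : t, ρ i (p z) * ((f (p y) z : ℝ) - f i z) := by
    funext z
    simp only [A, mul_sub, Finset.sum_sub_distrib, ← Finset.sum_mul, hsum]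
    ring
  rw [hA]
  refine continuousAt_const.mul (tendsto_finsetSum _ fun i _ => ?_)
  -- If `p y ∈ U i`, the difference of the two potentials is constant near `y`, since both have
  -- increment `φ` along small paths. Otherwise `ρ i` vanishes near `p y`.
  by_cases hi : p y ∈ U i
  · have hW : IsOpen (p ⁻¹' (U i ∩ U (p y))) := ((hU i).inter (hU _)).preimage p.continuous
    have hc : ContinuousAt (fun z => ρ i (p z) * ((f (p y) y : ℝ) - f i y)) y := by fun_prop
    refine hc.congr ?_
    filter_upwards [pathComponentIn_mem_nhds (hW.mem_nhds ⟨hi, hxU _⟩)] with z hz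
    obtain ⟨γ, hγ⟩ := hz
    let σ : C(Simplex 1, Y) := γ.toContinuousMap.comp stdSimplexHomeomorphUnitInterval
    have h0 : σ (vert 0) = y :=
      (congrArg γ stdSimplexHomeomorphUnitInterval_zero).trans γ.source
    have h1 : σ (vert 1) = z :=
      (congrArg γ stdSimplexHomeomorphUnitInterval_one).trans γ.target
    have e1 := hf i σ fun x => (hγ _).1
    have e2 := hf (p y) σ fun x => (hγ _).2
    rw [h0, h1] at e1 e2
    have e3 : (f (p y) z : ℝ) - f i z = f (p y) y - f i y := by
      have : f (p y) z - f i z = f (p y) y - f i y := by linarith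
      exact_mod_cast this
    rw [e3]
  · have hn : p y ∉ tsupport (ρ i) := fun h => hi (hρ i h)
    have hev : ∀ᶠ z in nhds y, ρ i (p z) * ((f (p y) z : ℝ) - f i z) = 0 := by
      filter_upwards [((isClosed_tsupport _).isOpen_compl.preimage p.continuous).mem_nhds hn]
        with z hz
      rw [image_eq_zero_of_notMem_tsupport hz, zero_mul]
    exact (continuousAt_const (y := (0 : ℝ))).congr (hev.mono fun z hz => hz.symm)

end Singular

/-! ### Vanishing of twice the cup product of two classes of degree one -/

namespace Singular

open SimplicialCohomology Opposite

variable {Y : Type} [TopologicalSpace Y]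

lemma cupCochain_ofMap (φ ψ : SingularCochain Y 1) (τ : C(Simplex 2, Y)) :
    cupCochain (show 1 + 1 = 2 from rfl) φ ψ (ofMap τ) =
      φ (ofMap (τ.comp (simplexMap ![0, 1]))) * ψ (ofMap (τ.comp (simplexMap ![1, 2]))) := by
  have h0 : ⇑(front (show 1 ≤ 2 by omega)).toOrderHom = ![0, 1] := by
    ext i; fin_cases i <;> rfl
  have h1 : ⇑(back (show 1 + 1 = 2 from rfl)).toOrderHom = ![1, 2] := by
    ext i; fin_cases i <;> rfl
  rw [cupCochain, map_ofMap, map_ofMap, h0, h1]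

lemma quasiperiodic_int {G : C(Y × ℝ, ℂ)} {b : C(Y, Circle)}
    (hper : ∀ y t, G (y, t + 2 * Real.pi) = G (y, t) * (b y : ℂ) ^ 2) (y : Y) (t : ℝ) (n : ℤ) :
    G (y, t + 2 * Real.pi * n) = G (y, t) * ((b y ^ (2 * n) : Circle) : ℂ) := by
  have hb : (b y : ℂ) ≠ 0 := (b y).coe_ne_zero
  induction n with
  | zero => simp
  | succ n ih =>
    rw [show t + 2 * Real.pi * ((n + 1 : ℤ) : ℝ) = t + 2 * Real.pi * (n : ℤ) + 2 * Real.pi by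
      push_cast; ring, hper, ih, mul_assoc, mul_add, zpow_add]
    simp [zpow_ofNat]
  | pred n ih =>
    have h := hper y (t + 2 * Real.pi * ((-n - 1 : ℤ) : ℝ))
    rw [show t + 2 * Real.pi * ((-n - 1 : ℤ) : ℝ) + 2 * Real.pi = t + 2 * Real.pi * (-n : ℤ) by
      push_cast; ring, ih] at h
    rw [eq_comm, ← mul_left_inj' (pow_ne_zero 2 hb), ← h, mul_assoc, ← Circle.coe_pow,
      ← Circle.coe_mul, ← zpow_natCast, ← zpow_add]
    congr 3
    push_cast
    ring

/-- Let `φ` and `ψ` be represented by the circle-valued maps `a` and `b`. A continuous function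
`G` on `Y × ℝ` which does not vanish on the infinite cyclic cover defined by `a`, and is multiplied
by `b²` under the deck transformation, makes `2 φ ∪ ψ` a coboundary. -/
theorem two_smul_cupCochain_mem_coboundaries {a b : C(Y, Circle)} {A B : Y → ℝ}
    {φ ψ : SingularCochain Y 1} (hφ : φ ∈ cocycles _ 1)
    (ha : Represents a A φ) (hb : Represents b B ψ) (G : C(Y × ℝ, ℂ))
    (hG : ∀ y t, Circle.exp t = a y → G (y, t) ≠ 0)
    (hper : ∀ y t, G (y, t + 2 * Real.pi) = G (y, t) * (b y : ℂ) ^ 2) :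
    (2 : ℤ) • cupCochain (show 1 + 1 = 2 from rfl) φ ψ ∈ coboundaries _ 2 := by
  -- The pair `(σ, θ)` is a lift of `σ` to the infinite cyclic cover, and `W` is a continuous
  -- argument of `G` along it.
  have hlift : ∀ {n : ℕ} (σ : C(Simplex n, Y)) (θ : C(Simplex n, ℝ)),
      (∀ x, Circle.exp (θ x) = a (σ x)) → ∃ W : C(Simplex n, ℝ),
        ∀ x, (‖G (σ x, θ x)‖ : ℂ) * Circle.exp (W x) = G (σ x, θ x) := fun σ θ hθ => by
    let g : C(_, ℂ) := G.comp (σ.prodMk θ)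
    have hg : ∀ x, g x ≠ 0 := fun x => hG _ _ (hθ x)
    obtain ⟨W, hW⟩ := HasArg.of_contractible _ (circleDirection g hg)
    exact ⟨W, fun x => by rw [hW]; exact norm_mul_circleDirection g hg x⟩
  have hΛ : ∀ y, ∃ l : ℝ, (‖G (y, A y)‖ : ℂ) * Circle.exp l = G (y, A y) := fun y => by
    obtain ⟨W, hW⟩ := hlift (n := 0) (.const _ y) (.const _ (A y)) fun x => ha.exp_arg y
    exact ⟨_, hW (vert 0)⟩
  choose Λ hΛ using hΛ
  have hcancel : ∀ {y : Y} {t : ℝ} {u v : Circle}, Circle.exp t = a y →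
      (‖G (y, t)‖ : ℂ) * u = ‖G (y, t)‖ * v → u = v := fun {y t u v} ht h =>
    Circle.ext (mul_left_cancel₀ (by simpa using hG y t ht) h)
  have hnorm : ∀ y t (n : ℤ), ‖G (y, t + 2 * Real.pi * n)‖ = ‖G (y, t)‖ := fun y t n => by
    rw [quasiperiodic_int hper, norm_mul, Circle.norm_coe, mul_one]
  -- The lift of `σ` starting at `A` ends at `A + 2π φ(σ)`, where `G` has acquired the factor `b ^
  -- (2 φ(σ))`. So the increment of `W` agrees with that of `Λ` plus `2 φ(σ) B` up to an integer
  -- multiple `κ σ` of `2π`, which does not depend on `θ` or `W`.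
  have hκ : ∀ σ : C(Simplex 1, Y), ∃ k : ℤ, ∀ θ W : C(Simplex 1, ℝ),
      (∀ x, Circle.exp (θ x) = a (σ x)) → θ (vert 0) = A (σ (vert 0)) →
      (∀ x, (‖G (σ x, θ x)‖ : ℂ) * Circle.exp (W x) = G (σ x, θ x)) →
      W (vert 1) - W (vert 0) = Λ (σ (vert 1)) - Λ (σ (vert 0)) +
        2 * φ (ofMap σ) * B (σ (vert 1)) + 2 * Real.pi * k := by
    intro σ
    obtain ⟨θ, hθ, hθ0⟩ := (HasArg.of_contractible (Simplex 1)).exists_eq (a.comp σ) (vert 0)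
      (ha.exp_arg _)
    obtain ⟨W, hW⟩ := hlift σ θ hθ
    have h0 : Circle.exp (W (vert 0)) = Circle.exp (Λ (σ (vert 0))) := by
      refine hcancel (ha.exp_arg (σ (vert 0))) ?_
      rw [hΛ, ← hθ0, hW]
    have h1 : Circle.exp (W (vert 1)) =
        Circle.exp (Λ (σ (vert 1))) * b (σ (vert 1)) ^ (2 * φ (ofMap σ)) := by
      have e := ha.increment σ θ hθ
      have e1 : θ (vert 1) = A (σ (vert 1)) + 2 * Real.pi * φ (ofMap σ) := by linarith
      refine hcancel (hθ (vert 1)) ?_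
      rw [hW, e1, hnorm, quasiperiodic_int hper, Circle.coe_mul,
        ← mul_assoc, hΛ]
    obtain ⟨k, hk⟩ := Circle.exp_eq_exp.1 (show Circle.exp (W (vert 1) - W (vert 0)) =
        Circle.exp (Λ (σ (vert 1)) - Λ (σ (vert 0)) +
          ((2 * φ (ofMap σ) : ℤ) : ℝ) * B (σ (vert 1))) by
      rw [Circle.exp_add, Circle.exp_sub, Circle.exp_sub, h0, h1, Circle.exp_intCast_mul,
        hb.exp_arg]
      exact mul_div_right_comm _ _ _)
    refine ⟨k, fun θ' W' hθ' hθ'0 hW' => ?_⟩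
    have hθθ : θ' = θ := by
      ext x
      have := sub_eq_sub_of_circleExp_eq θ'.continuous θ.continuous
        (fun x => (hθ' x).trans (hθ x).symm) x (vert 0)
      linarith
    subst hθθ
    have hWW := sub_eq_sub_of_circleExp_eq W'.continuous W.continuous
      (fun x => hcancel (hθ x) ((hW' x).trans (hW x).symm)) (vert 0) (vert 1)
    push_cast at hk
    linarith
  choose κ hκ using hκ
  let κ' : SingularCochain Y 1 := fun x => -κ (exists_ofMap x).choose
  have hκ' : ∀ σ : C(Simplex 1, Y), κ' (ofMap σ) = -κ σ := fun σ => by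
    have h : σ = (exists_ofMap (ofMap σ)).choose :=
      (TopCat.toSSetObjEquiv _ _).symm.injective (exists_ofMap (ofMap σ)).choose_spec
    simp only [κ', ← h]
  refine ⟨κ', ?_⟩
  funext x
  obtain ⟨τ, rfl⟩ := exists_ofMap x
  rw [coboundary_one_ofMap, hκ', hκ', hκ', Pi.smul_apply, cupCochain_ofMap]
  obtain ⟨θ, hθ, hθ0⟩ := (HasArg.of_contractible (Simplex 2)).exists_eq (a.comp τ) (vert 0)
    (ha.exp_arg _)
  obtain ⟨β, hβ⟩ := HasArg.of_contractible (Simplex 2) (b.comp τ)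
  obtain ⟨W, hW⟩ := hlift τ θ hθ
  have e01 := hκ (τ.comp (simplexMap ![0, 1])) (θ.comp (simplexMap ![0, 1]))
    (W.comp (simplexMap ![0, 1])) (fun x => hθ _) (by simpa using hθ0) (fun x => hW _)
  have e02 := hκ (τ.comp (simplexMap ![0, 2])) (θ.comp (simplexMap ![0, 2]))
    (W.comp (simplexMap ![0, 2])) (fun x => hθ _) (by simpa using hθ0) (fun x => hW _)
  have ea := ha.increment (τ.comp (simplexMap ![0, 1])) (θ.comp (simplexMap ![0, 1]))
    (fun x => hθ _)
  have eb := hb.increment (τ.comp (simplexMap ![1, 2])) (β.comp (simplexMap ![1, 2]))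
    (fun x => hβ _)
  have ec := cocycle_triangle hφ τ
  generalize hn : φ (ofMap (τ.comp (simplexMap ![0, 1]))) = n at *
  -- On the edge `[1, 2]` the lift `θ` starts at `A + 2πn`, but `κ` refers to the lift starting at
  -- `A`. Shifting by `-2πn` changes the argument of `G` by `-2nβ`, and the increment of `β` along
  -- this edge contributes the term `2nψ` of the cup product.
  have hθ' : ∀ x, θ x = (θ x + 2 * Real.pi * ((-n : ℤ) : ℝ)) + 2 * Real.pi * n := fun x => by
    push_cast; ring
  have e12 := hκ (τ.comp (simplexMap ![1, 2]))
    ⟨fun x => θ (simplexMap ![1, 2] x) + 2 * Real.pi * ((-n : ℤ) : ℝ), by fun_prop⟩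
    ⟨fun x => W (simplexMap ![1, 2] x) + ((2 * -n : ℤ) : ℝ) * β (simplexMap ![1, 2] x),
      by fun_prop⟩
    (fun x => (circleExp_add_two_pi_mul_int _ _).trans (hθ _))
    (by
      simp only [ContinuousMap.comp_apply, simplexMap_vert, ContinuousMap.coe_mk] at ea ⊢
      simp only [Matrix.cons_val_zero, Matrix.cons_val_one] at ea ⊢
      push_cast
      linarith)
    (fun x => by
      simp only [ContinuousMap.comp_apply, ContinuousMap.coe_mk]
      rw [hnorm, quasiperiodic_int hper, Circle.exp_add, Circle.exp_intCast_mul, hβ,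
        Circle.coe_mul, ← mul_assoc, hW]
      rfl)
  simp only [ContinuousMap.comp_apply, simplexMap_vert, ContinuousMap.coe_mk,
    Matrix.cons_val_zero, Matrix.cons_val_one] at e01 e02 e12 eb
  have ec' := congrArg (Int.cast : ℤ → ℝ) ec
  push_cast at ec' e12
  have key : (2 * Real.pi) * ((-κ (τ.comp (simplexMap ![1, 2])) -
      -κ (τ.comp (simplexMap ![0, 2])) + -κ (τ.comp (simplexMap ![0, 1])) : ℤ) : ℝ) =
      (2 * Real.pi) * ((2 * (n * ψ (ofMap (τ.comp (simplexMap ![1, 2])))) : ℤ) : ℝ) := by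
    push_cast
    linear_combination e12 - e02 + e01 + 2 * (n : ℝ) * eb + 2 * B (τ (vert 2)) * ec'
  exact_mod_cast mul_left_cancel₀ Real.two_pi_pos.ne' key

/-- If `2 φ ∪ ψ` is a coboundary, then the triple products of the classes of `φ` and `ψ` with any
third class vanish. -/
lemma tripleCupForm_eq_zero (μ : Homology Y 3)
    (φ ψ : cocycles (TopCat.toSSet.obj (TopCat.of Y)) 1) (γ : Cohomology Y 1)
    (h : (2 : ℤ) • cupCochain (show 1 + 1 = 2 from rfl) (φ : SingularCochain Y 1) ψ ∈
      coboundaries _ 2) :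
    tripleCupForm μ (QuotientAddGroup.mk φ) (QuotientAddGroup.mk ψ) γ = 0 := by
  have h0 : (2 : ℤ) • cup (X := Y) (show 1 + 1 = 2 from rfl) (QuotientAddGroup.mk φ)
      (QuotientAddGroup.mk ψ) = 0 :=
    (QuotientAddGroup.eq_zero_iff
      ((2 : ℤ) • (⟨_, cupCochain_mem_cocycles (show 1 + 1 = 2 from rfl) φ.2 ψ.2⟩ :
        cocycles (TopCat.toSSet.obj (TopCat.of Y)) 2))).2 h
  have h1 : (2 : ℤ) • tripleCupForm μ (QuotientAddGroup.mk φ) (QuotientAddGroup.mk ψ) γ = 0 := by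
    have h2 (ξ : Cohomology Y 2) : cup (show 2 + 1 = 3 from rfl) ((2 : ℤ) • ξ) γ =
        (2 : ℤ) • cup (show 2 + 1 = 3 from rfl) ξ γ :=
      DFunLike.congr_fun (map_zsmul (cup (X := Y) (show 2 + 1 = 3 from rfl)) 2 ξ) γ
    have h3 (ξ : Cohomology Y 3) : kronecker ((2 : ℤ) • ξ) μ = (2 : ℤ) • kronecker ξ μ :=
      DFunLike.congr_fun
        (map_zsmul (SimplicialCohomology.kronecker (K := TopCat.toSSet.obj (TopCat.of Y))) 2 ξ) μ
    rw [tripleCupForm, ← h3, ← h2, h0, map_zero, kronecker, AddMonoidHom.zero_apply, map_zero]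
    rfl
  simpa using h1

end Singular

/-! ### The topology of double branched covers -/

lemma isOpenMap_complex_sq : IsOpenMap fun z : ℂ => z ^ 2 := by
  have hf : AnalyticOnNhd ℂ (fun z : ℂ => z ^ 2) Set.univ := fun z _ => by fun_prop
  rcases hf.is_constant_or_isOpen isPreconnected_univ with ⟨w, hw⟩ | h
  · have h0 := hw 0 trivial
    have h1 := hw 1 trivial
    rw [← h0] at h1
    norm_num at h1
  · exact fun s hs => h s (Set.subset_univ s) hs

lemma exists_involution_of_encard_eq_two {F : Type*} (h : ENat.card F = 2) :
    ∃ s : F → F, (∀ i, s (s i) = i) ∧ ∀ i j, j = i ∨ j = s i := by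
  classical
  rw [← Set.encard_univ, Set.encard_eq_two] at h
  obtain ⟨x, y, hxy, h⟩ := h
  have hF : ∀ i, i = x ∨ i = y := fun i => by
    have : i ∈ (Set.univ : Set F) := trivial
    rw [h] at this
    exact this
  refine ⟨Equiv.swap x y, Equiv.swap_apply_self x y, fun i j => ?_⟩
  rcases hF i with rfl | rfl <;> rcases hF j with rfl | rfl <;> simp

/-- Data of a two-to-one open surjection with its deck involution over a set `U` of the base. -/
structure IsDeckOver {Y B : Type*} [TopologicalSpace Y] [TopologicalSpace B] (p : Y → B)
    (U : Set B) (τ : p ⁻¹' U → p ⁻¹' U) : Prop where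
  continuous : Continuous τ
  map : ∀ y, p (τ y) = p y
  involutive : ∀ y, τ (τ y) = y
  fiber : ∀ y z : p ⁻¹' U, p y = p z → z = y ∨ z = τ y
  surjective : ∀ x ∈ U, ∃ y, p y = x
  isOpenMap : IsOpenMap (U.restrictPreimage p)

lemma IsDeckOver.of_isEvenlyCovered {Y B : Type*} [TopologicalSpace Y] [TopologicalSpace B]
    {p : Y → B} {U : Set B} {F : Type*} [TopologicalSpace F] [DiscreteTopology F]
    (hF : ENat.card F = 2) (H : p ⁻¹' U ≃ₜ U × F) (hH : ∀ x, (H x).1.1 = p x) :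
    ∃ τ, IsDeckOver p U τ := by
  obtain ⟨s, hs, hs'⟩ := exists_involution_of_encard_eq_two hF
  have hp : ∀ q, p (H.symm q) = q.1 := fun q => by rw [← hH, H.apply_symm_apply]
  refine ⟨fun y => H.symm ((H y).1, s (H y).2), ?_, fun y => ?_, fun y => ?_, fun y z h => ?_,
    fun x hx => ?_, ?_⟩
  · have : Continuous s := continuous_of_discreteTopology
    fun_prop
  · rw [hp, hH]
  · simp [hs]
  · have h1 : (H z).1 = (H y).1 := Subtype.ext (by rw [hH, hH, h])
    refine (hs' (H y).2 (H z).2).imp (fun h2 => H.injective (Prod.ext h1 h2)) fun h2 =>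
      H.injective (Prod.ext ?_ ?_)
    · rw [h1, H.apply_symm_apply]
    · rw [h2, H.apply_symm_apply]
  · have : Nonempty F := by
      by_contra hn
      rw [not_nonempty_iff] at hn
      simp [(ENat.card_eq_zero_iff_empty F).2 hn] at hF
    exact ⟨H.symm (⟨x, hx⟩, Classical.arbitrary F), hp _⟩
  · have : U.restrictPreimage p = Prod.fst ∘ H := funext fun y => Subtype.ext (hH y).symm
    rw [this]
    exact isOpenMap_fst.comp H.isOpenMap

/-- In the branched coordinates the involution is `(z, t) ↦ (-z, t)`. Surjectivity is the existence
of complex square roots, and openness is that of `z ↦ z²`. -/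
lemma IsDeckOver.of_branched {Y B : Type*} [TopologicalSpace Y] [TopologicalSpace B]
    {p : Y → B} {U : Set B} (e : U ≃ₜ ℂ × ℝ) (e' : p ⁻¹' U ≃ₜ ℂ × ℝ)
    (he : ∀ y : p ⁻¹' U, e ⟨p y, y.2⟩ = ((e' y).1 ^ 2, (e' y).2)) :
    ∃ τ, IsDeckOver p U τ := by
  have hp : ∀ y z : p ⁻¹' U, p y = p z ↔ (e' y).1 ^ 2 = (e' z).1 ^ 2 ∧ (e' y).2 = (e' z).2 :=
    fun y z => by
      rw [← Prod.mk_inj, ← he, ← he, e.injective.eq_iff, Subtype.mk.injEq]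
  refine ⟨fun y => e'.symm (-(e' y).1, (e' y).2), by fun_prop, fun y => ?_, fun y => ?_,
    fun y z h => ?_, fun x hx => ?_, ?_⟩
  · rw [hp, e'.apply_symm_apply]
    simp
  · simp
  · obtain ⟨h1, h2⟩ := (hp y z).1 h
    refine (sq_eq_sq_iff_eq_or_eq_neg.1 h1.symm).imp (fun h3 => e'.injective (Prod.ext h3 h2.symm))
      fun h3 => e'.injective (Prod.ext ?_ ?_)
    · rw [h3, e'.apply_symm_apply]
    · rw [h2, e'.apply_symm_apply]
  · obtain ⟨z, hz⟩ := IsSquare.exists_sq _ (IsAlgClosed.exists_eq_mul_self (e ⟨x, hx⟩).1)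
    refine ⟨e'.symm (z, (e ⟨x, hx⟩).2), ?_⟩
    have := he (e'.symm (z, (e ⟨x, hx⟩).2))
    rw [e'.apply_symm_apply] at this
    exact congrArg Subtype.val (e.injective (this.trans (Prod.ext hz.symm rfl)))
  · have : U.restrictPreimage p = e.symm ∘ Prod.map (fun z : ℂ => z ^ 2) id ∘ e' :=
      funext fun y => by
        simp only [Function.comp_apply]
        rw [e.eq_symm_apply]
        exact he y
    rw [this]
    exact e.symm.isOpenMap.comp ((isOpenMap_complex_sq.prodMap IsOpenMap.id).comp e'.isOpenMap)

/-- The local deck involutions fit together. -/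
lemma exists_deck_involution {Y B : Type*} [TopologicalSpace Y] [TopologicalSpace B] {p : Y → B}
    (hp : Continuous p)
    (h : ∀ x, ∃ U : Set B, IsOpen U ∧ x ∈ U ∧ ∃ τ, IsDeckOver p U τ) :
    IsOpenQuotientMap p ∧ ∃ τ : C(Y, Y), (∀ y, p (τ y) = p y) ∧ (∀ y, τ (τ y) = y) ∧
      ∀ y z, p y = p z → z = y ∨ z = τ y := by
  choose U hU hxU τ hτ using h
  let T : Y → Y := fun y => τ (p y) ⟨y, hxU _⟩
  -- Any local involution sends `y` to the other point of its fibre, or fixes `y` if there is none,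
  -- so its value does not depend on the neighbourhood.
  have hT : ∀ (x : B) (y : p ⁻¹' U x), T y = τ x y := fun x y => by
    have h1 : p (T y) = p y := (hτ _).map ⟨y, hxU _⟩
    have h2 : p (τ x y) = p y := (hτ x).map y
    rcases (hτ x).fiber y ⟨T y, by rw [Set.mem_preimage, h1]; exact y.2⟩ h1.symm with h3 | h3
    · have h3 : T y = y := congrArg Subtype.val h3
      rcases (hτ (p y)).fiber ⟨y, hxU _⟩ ⟨τ x y, by rw [Set.mem_preimage, h2]; exact hxU _⟩
        h2.symm with h4 | h4
      · rw [h3]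
        exact (congrArg Subtype.val h4).symm
      · exact (congrArg Subtype.val h4).symm
    · exact congrArg Subtype.val h3
  have hpT : ∀ y, p (T y) = p y := fun y => (hτ _).map ⟨y, hxU _⟩
  refine ⟨⟨fun x => (hτ x).surjective x (hxU x), hp, ?_⟩, ⟨T, ?_⟩, hpT, fun y => ?_,
    fun y z hyz => ?_⟩
  · rw [isOpenMap_iff_nhds_le]
    intro y W hW
    have h1 := (hτ (p y)).isOpenMap.image_mem_nhds (x := ⟨y, hxU _⟩)
      (preimage_coe_mem_nhds_subtype.2 (mem_nhdsWithin_of_mem_nhds hW))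
    have h2 := (hU (p y)).isOpenMap_subtype_val.image_mem_nhds h1
    refine Filter.mem_of_superset h2 ?_
    rintro _ ⟨_, ⟨z, hz, rfl⟩, rfl⟩
    exact hz
  · rw [continuous_iff_continuousAt]
    intro y
    have h1 : ContinuousOn T (p ⁻¹' U (p y)) := by
      rw [continuousOn_iff_continuous_domRestrict]
      exact (continuous_subtype_val.comp (hτ (p y)).continuous).congr fun z => (hT _ z).symm
    exact h1.continuousAt (((hU _).preimage hp).mem_nhds (hxU _))
  · have h1 := hT (p y) (τ (p y) ⟨y, hxU _⟩)
    rw [(hτ _).involutive] at h1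
    exact h1
  · exact ((hτ (p y)).fiber ⟨y, hxU _⟩ ⟨z, by rw [Set.mem_preimage, ← hyz]; exact hxU _⟩ hyz).imp
      (congrArg Subtype.val) (congrArg Subtype.val)

lemma locallyPathConnectedSpace_of_open_cover {Y : Type*} [TopologicalSpace Y]
    (h : ∀ y : Y, ∃ N : Set Y, IsOpen N ∧ y ∈ N ∧ LocallyPathConnectedSpace N) :
    LocallyPathConnectedSpace Y := by
  rw [locallyPathConnectedSpace_iff_pathComponentIn_mem_nhds]
  intro y u hu hy
  obtain ⟨N, hN, hyN, hlpc⟩ := h y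
  obtain ⟨s, ⟨hs, hsc⟩, hsu⟩ := (LocallyPathConnectedSpace.path_connected_basis
    (⟨y, hyN⟩ : N)).mem_iff.1 ((hu.preimage continuous_subtype_val).mem_nhds hy)
  have h1 : IsPathConnected ((↑) '' s : Set Y) := hsc.image continuous_subtype_val
  refine Filter.mem_of_superset (hN.isOpenMap_subtype_val.image_mem_nhds hs) ?_
  exact h1.subset_pathComponentIn ⟨_, mem_of_mem_nhds hs, rfl⟩ (Set.image_subset_iff.2 hsu)

lemma exists_contractible_open_subset {M : Type*} [TopologicalSpace M] {E : Type*}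
    [NormedAddCommGroup E] [NormedSpace ℝ E] [ChartedSpace E M] {U : Set M} (hU : IsOpen U) {x : M}
    (hx : x ∈ U) : ∃ V ⊆ U, IsOpen V ∧ x ∈ V ∧ ContractibleSpace V := by
  let c := chartAt E x
  have hxc : x ∈ c.source := mem_chart_source E x
  have hO : IsOpen (c.target ∩ c.symm ⁻¹' U) := c.isOpen_inter_preimage_symm hU
  obtain ⟨r, hr, hball⟩ := Metric.isOpen_iff.1 hO (c x)
    ⟨c.map_source hxc, by rwa [Set.mem_preimage, c.left_inv hxc]⟩
  let f := c.symm.restrOpen (Metric.ball (c x) r) Metric.isOpen_ball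
  have hs : f.source = Metric.ball (c x) r := by
    rw [OpenPartialHomeomorph.restrOpen_source]
    exact Set.inter_eq_right.2 fun z hz => (hball hz).1
  refine ⟨f.target, fun z hz => ?_, f.open_target, ?_, ?_⟩
  · have h1 := f.map_target hz
    rw [hs] at h1
    have h2 := (hball h1).2
    have h3 : c.symm (f.symm z) = z := f.right_inv hz
    rwa [Set.mem_preimage, h3] at h2
  · have h1 : c x ∈ f.source := hs ▸ Metric.mem_ball_self hr
    have h2 := f.map_source h1
    rwa [show f (c x) = x from c.left_inv hxc] at h2
  · have : ContractibleSpace f.source := hs ▸ Metric.contractibleSpace_ball hr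
    exact f.toHomeomorphSourceTarget.symm.contractibleSpace

/-- An evenly covering homeomorphism restricts to smaller subsets of the base. -/
def restrictTrivialization {Y B F : Type*} [TopologicalSpace Y] [TopologicalSpace B]
    [TopologicalSpace F] {p : Y → B} (hp : Continuous p) {U V : Set B} (hVU : V ⊆ U)
    (H : p ⁻¹' U ≃ₜ U × F) (hH : ∀ x, (H x).1.1 = p x) : p ⁻¹' V ≃ₜ V × F where
  toFun y := (⟨p y, y.2⟩, (H ⟨y, hVU y.2⟩).2)
  invFun q := ⟨H.symm (⟨q.1, hVU q.1.2⟩, q.2), by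
    rw [Set.mem_preimage, ← hH, H.apply_symm_apply]
    exact q.1.2⟩
  left_inv y := by
    refine Subtype.ext ?_
    have : (⟨⟨p y, hVU y.2⟩, (H ⟨y, hVU y.2⟩).2⟩ : U × F) = H ⟨y, hVU y.2⟩ :=
      Prod.ext (Subtype.ext (hH ⟨y, hVU y.2⟩).symm) rfl
    simp only [this, H.symm_apply_apply]
  right_inv q := by
    refine Prod.ext (Subtype.ext ?_) ?_
    · change p (H.symm (⟨q.1, hVU q.1.2⟩, q.2)) = q.1
      rw [← hH, H.apply_symm_apply]
    · change (H (H.symm (⟨q.1, hVU q.1.2⟩, q.2))).2 = q.2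
      rw [H.apply_symm_apply]
  continuous_toFun := by fun_prop
  continuous_invFun := by fun_prop

/-! ### Local models, descent to the 3-sphere and equivariant circle-valued maps -/

namespace IsDoubleBranchedCover

variable {Y : Type} [TopologicalSpace Y] {n : ℕ} {L : SmoothLink n} {p : Y → ThreeSphere}

/-- At a branch point the preimage is the single piece `ℂ × ℝ`; elsewhere it consists of two copies
of a chart ball. This form serves both `hasPotential_of_homeomorph` and local path connectedness. -/
lemma exists_local_model (hp : IsDoubleBranchedCover L p) (x : ThreeSphere) :
    ∃ U : Set ThreeSphere, IsOpen U ∧ x ∈ U ∧ ∃ (C F : Type) (_ : TopologicalSpace C)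
      (_ : TopologicalSpace F), ContractibleSpace C ∧ LocallyPathConnectedSpace C ∧
        DiscreteTopology F ∧ Nonempty (p ⁻¹' U ≃ₜ C × F) := by
  by_cases hx : x ∈ L.carrier
  · obtain ⟨U, hU, hxU, -, e', -⟩ := hp.branched x hx
    exact ⟨U, hU, hxU, ℂ × ℝ, PUnit, inferInstance, inferInstance, inferInstance, inferInstance,
      inferInstance, ⟨e'.trans (Homeomorph.prodPUnit _).symm⟩⟩
  · obtain ⟨hd, U, hxU, hU, -, H, hH⟩ := hp.isCoveringMapOn x hx
    obtain ⟨V, hVU, hV, hxV, hVc⟩ :=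
      exists_contractible_open_subset (E := EuclideanSpace ℝ (Fin 3)) hU hxU
    have : LocallyPathConnectedSpace ThreeSphere :=
      ChartedSpace.locallyPathConnectedSpace (EuclideanSpace ℝ (Fin 3)) _
    exact ⟨V, hV, hxV, V, p ⁻¹' {x}, inferInstance, inferInstance, hVc,
      hV.locallyPathConnectedSpace, hd, ⟨restrictTrivialization hp.continuous hVU H hH⟩⟩

lemma locallyPathConnectedSpace (hp : IsDoubleBranchedCover L p) :
    LocallyPathConnectedSpace Y := by
  refine locallyPathConnectedSpace_of_open_cover fun y => ?_
  obtain ⟨U, hU, hyU, C, F, _, _, -, _, _, ⟨e⟩⟩ := hp.exists_local_model (p y)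
  exact ⟨_, hU.preimage hp.continuous, hyU, e.isOpenEmbedding.locallyPathConnectedSpace⟩

/-- A double branched cover is an open quotient map with a deck involution. -/
lemma exists_deck_involution (hp : IsDoubleBranchedCover L p) :
    IsOpenQuotientMap p ∧ ∃ τ : C(Y, Y), (∀ y, p (τ y) = p y) ∧ (∀ y, τ (τ y) = y) ∧
      ∀ y z, p y = p z → z = y ∨ z = τ y := by
  refine _root_.exists_deck_involution hp.continuous fun x => ?_
  by_cases hx : x ∈ L.carrier
  · obtain ⟨U, hU, hxU, e, e', -, he⟩ := hp.branched x hx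
    exact ⟨U, hU, hxU, IsDeckOver.of_branched e e' he⟩
  · obtain ⟨hd, U, hxU, hU, -, H, hH⟩ := hp.isCoveringMapOn x hx
    exact ⟨U, hU, hxU, IsDeckOver.of_isEvenlyCovered (by
      rw [← hp.encard_fiber x hx]
      rfl) H hH⟩

/-- Functions on the cover that are invariant under the deck involution descend. -/
lemma exists_descent (hp : IsDoubleBranchedCover L p) {τ : C(Y, Y)}
    (hτ : ∀ y z, p y = p z → z = y ∨ z = τ y) {Z : Type*} [TopologicalSpace Z] (f : C(Y, Z))
    (hf : ∀ y, f (τ y) = f y) : ∃ g : C(ThreeSphere, Z), ∀ y, g (p y) = f y := by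
  have hq : Topology.IsQuotientMap (⟨p, hp.continuous⟩ : C(Y, ThreeSphere)) :=
    hp.exists_deck_involution.1.isQuotientMap
  have hff : Function.FactorsThrough f (⟨p, hp.continuous⟩ : C(Y, ThreeSphere)) :=
    fun y z hyz => by
      rcases hτ y z hyz with rfl | rfl
      · rfl
      · exact (hf y).symm
  exact ⟨hq.lift f hff, fun y => DFunLike.congr_fun (hq.lift_comp f hff) y⟩

/-- Every integral cocycle of degree one on a double branched cover of the 3-sphere is
represented by a circle-valued map that the deck involution inverts. -/
theorem exists_represents_inv (hp : IsDoubleBranchedCover L p) {τ : C(Y, Y)}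
    (hpτ : ∀ y, p (τ y) = p y) (hττ : ∀ y, τ (τ y) = y)
    (hτ : ∀ y z, p y = p z → z = y ∨ z = τ y) {φ : Singular.SingularCochain Y 1}
    (hφ : φ ∈ SimplicialCohomology.cocycles _ 1) :
    ∃ (a : C(Y, Circle)) (A : Y → ℝ), Singular.Represents a A φ ∧ ∀ y, a (τ y) = (a y)⁻¹ := by
  have := hp.locallyPathConnectedSpace
  obtain ⟨a, A, ha⟩ := Singular.exists_represents ⟨p, hp.continuous⟩ hφ fun x => by
    obtain ⟨U, hU, hxU, C, F, _, _, _, _, _, ⟨e⟩⟩ := hp.exists_local_model x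
    exact ⟨U, hU, hxU, Singular.hasPotential_of_homeomorph hφ e⟩
  -- The product `a · (a ∘ τ)` is invariant, so it is `exp (r ∘ p)` for a function `r` on the
  -- 3-sphere. Multiplying `a` by `exp (-r ∘ p / 2)` makes the product equal to 1.
  obtain ⟨g, hg⟩ := hp.exists_descent hτ (a * a.comp τ) fun y => by
    simp [hττ, mul_comm]
  obtain ⟨r, hr⟩ := HasArg.sphere (E := EuclideanSpace ℝ (Fin 4)) (by simp) g
  refine ⟨_, _, ha.mul_exp ⟨fun y => -(r (p y) / 2), by have := hp.continuous; fun_prop⟩,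
    fun y => ?_⟩
  have h1 : a y * a (τ y) = Circle.exp (r (p y) / 2) * Circle.exp (r (p y) / 2) := by
    rw [← Circle.exp_add, add_halves, hr, hg]
    rfl
  rw [eq_inv_iff_mul_eq_one]
  simp only [ContinuousMap.mul_apply, ContinuousMap.comp_apply, ContinuousMap.coe_mk, hpτ,
    Circle.exp_neg]
  rw [mul_mul_mul_comm, mul_comm (a (τ y)), h1]
  group

end IsDoubleBranchedCover

/-! ### An even quasi-periodic frame on the 2-torus -/

/-- The power of `b` jumps only where `u` is an integer. There `g` vanishes, and since the power has
modulus 1 the product tends to 0. -/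
lemma continuous_mul_zpow_floor {X : Type*} [TopologicalSpace X] {u g : X → ℝ} {b : X → Circle}
    (hu : Continuous u) (hg : Continuous g) (hb : Continuous b)
    (hgu : ∀ x (n : ℤ), u x = n → g x = 0) (m : ℤ) :
    Continuous fun x => (g x : ℂ) * ((b x ^ (2 * ⌊u x⌋ + m) : Circle) : ℂ) := by
  rw [continuous_iff_continuousAt]
  intro x
  by_cases hx : u x = ⌊u x⌋
  · have h0 : g x = 0 := hgu x _ hx
    rw [ContinuousAt, h0, Complex.ofReal_zero, zero_mul]
    refine squeeze_zero_norm (a := fun y => ‖g y‖) (fun y => ?_) ?_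
    · rw [norm_mul, Circle.norm_coe, mul_one, Complex.norm_real]
    · have := hg.norm.tendsto x
      rwa [h0, norm_zero] at this
  · have h1 : ContinuousAt (fun y => (g y : ℂ) * ((b y ^ (2 * ⌊u x⌋ + m) : Circle) : ℂ)) x :=
      ((Complex.continuous_ofReal.comp hg).mul
        (continuous_subtype_val.comp (hb.zpow _))).continuousAt
    refine h1.congr ?_
    have h2 : Set.Ioo (⌊u x⌋ : ℝ) (⌊u x⌋ + 1) ∈ nhds (u x) :=
      Ioo_mem_nhds (lt_of_le_of_ne (Int.floor_le _) (Ne.symm hx)) (Int.lt_floor_add_one _)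
    filter_upwards [hu.continuousAt h2] with y hy
    rw [Int.floor_eq_iff.2 ⟨hy.1.le, hy.2⟩]

lemma floor_neg_of_not_int {u : ℝ} (hu : ∀ n : ℤ, u ≠ n) : ⌊-u⌋ = -⌊u⌋ - 1 := by
  rw [Int.floor_eq_iff]
  push_cast
  have h1 := lt_of_le_of_ne (Int.floor_le u) (hu _).symm
  have h2 := Int.lt_floor_add_one u
  constructor <;> linarith

lemma sin_half_eq_zero {t : ℝ} {n : ℤ} (h : t / (2 * Real.pi) = n) : Real.sin (t / 2) = 0 := by
  have : t / 2 = n * Real.pi := by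
    rw [← h]
    field_simp
  rw [this, Real.sin_int_mul_pi]

lemma cos_half_eq_zero {t : ℝ} {n : ℤ} (h : t / (2 * Real.pi) + 1 / 2 = n) :
    Real.cos (t / 2) = 0 := by
  have : t / 2 = n * Real.pi - Real.pi / 2 := by
    rw [← h]
    field_simp
    ring
  rw [this, Real.cos_sub_pi_div_two, Real.sin_int_mul_pi]

/-- The unit vector `(|cos (t/2)| b^(2⌊t/2π + 1/2⌋), |sin (t/2)| b^(2⌊t/2π⌋ + 1))`. -/
noncomputable def torusFrame (t : ℝ) (b : Circle) : EuclideanSpace ℂ (Fin 2) :=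
  -- The `+ 0` puts both coordinates in the form of `continuous_mul_zpow_floor`.
  !₂[((|Real.cos (t / 2)| : ℝ) : ℂ) * ((b ^ (2 * ⌊t / (2 * Real.pi) + 1 / 2⌋ + 0) : Circle) : ℂ),
    ((|Real.sin (t / 2)| : ℝ) : ℂ) * ((b ^ (2 * ⌊t / (2 * Real.pi)⌋ + 1) : Circle) : ℂ)]

lemma continuous_torusFrame : Continuous fun q : ℝ × Circle => torusFrame q.1 q.2 := by
  refine (PiLp.continuous_toLp 2 _).comp (continuous_pi fun i => ?_)
  fin_cases i
  · exact continuous_mul_zpow_floor (u := fun q : ℝ × Circle => q.1 / (2 * Real.pi) + 1 / 2)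
      (g := fun q => |Real.cos (q.1 / 2)|) (by fun_prop) (by fun_prop) continuous_snd
      (fun q n h => by rw [cos_half_eq_zero h, abs_zero]) 0
  · exact continuous_mul_zpow_floor (u := fun q : ℝ × Circle => q.1 / (2 * Real.pi))
      (g := fun q => |Real.sin (q.1 / 2)|) (by fun_prop) (by fun_prop) continuous_snd
      (fun q n h => by rw [sin_half_eq_zero h, abs_zero]) 1

lemma norm_torusFrame (t : ℝ) (b : Circle) : ‖torusFrame t b‖ = 1 := by
  rw [EuclideanSpace.norm_eq, Fin.sum_univ_two]
  simp only [torusFrame, PiLp.toLp_apply, Matrix.cons_val_zero, Matrix.cons_val_one, norm_mul,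
    Circle.norm_coe, mul_one, Complex.norm_real, Real.norm_eq_abs, abs_abs, sq_abs]
  rw [Real.cos_sq_add_sin_sq, Real.sqrt_one]

/-- Both floors go up by one, which produces `b²`; the signs of the cosine and the sine are absorbed
by the absolute values. -/
lemma torusFrame_add_two_pi (t : ℝ) (b : Circle) :
    torusFrame (t + 2 * Real.pi) b = ((b : ℂ) ^ 2) • torusFrame t b := by
  have h1 : (t + 2 * Real.pi) / 2 = t / 2 + Real.pi := by ring
  have h2 : (t + 2 * Real.pi) / (2 * Real.pi) = t / (2 * Real.pi) + 1 := by field_simp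
  have h3 : t / (2 * Real.pi) + 1 + 1 / 2 = t / (2 * Real.pi) + 1 / 2 + 1 := by ring
  have h4 : ∀ m k : ℤ, ((b ^ (2 * (m + 1) + k) : Circle) : ℂ) =
      (b : ℂ) ^ 2 * ((b ^ (2 * m + k) : Circle) : ℂ) := fun m k => by
    rw [← Circle.coe_pow, ← Circle.coe_mul, ← zpow_natCast, ← zpow_add]
    congr 2
    push_cast
    ring
  ext i
  fin_cases i
  · simp only [torusFrame, h1, h2, h3, Real.cos_add_pi, abs_neg, Int.floor_add_one, h4]
    simp
    ring
  · simp only [torusFrame, h1, h2, Real.sin_add_pi, abs_neg, Int.floor_add_one, h4]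
    simp
    ring

/-- Off the jumps, `⌊-u⌋ = -⌊u⌋ - 1`, so the offsets `1/2` and `+ 1` make both exponents odd under
`t ↦ -t`, which cancels the inversion of `b`. At a jump the coefficient is zero. -/
lemma torusFrame_neg_inv (t : ℝ) (b : Circle) : torusFrame (-t) b⁻¹ = torusFrame t b := by
  ext i
  fin_cases i
  · by_cases h : ∃ n : ℤ, t / (2 * Real.pi) + 1 / 2 = n
    · obtain ⟨n, hn⟩ := h
      simp [torusFrame, neg_div, cos_half_eq_zero hn]
    · push Not at h
      have h1 : -t / (2 * Real.pi) + 1 / 2 = -(t / (2 * Real.pi) + 1 / 2) + 1 := by ring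
      have h2 : b⁻¹ ^ (2 * ⌊-t / (2 * Real.pi) + 1 / 2⌋ + 0) =
          b ^ (2 * ⌊t / (2 * Real.pi) + 1 / 2⌋ + 0) := by
        rw [h1, Int.floor_add_one, floor_neg_of_not_int h, inv_zpow']
        congr 1
        ring
      change ((|Real.cos (-t / 2)| : ℝ) : ℂ) * ((b⁻¹ ^ _ : Circle) : ℂ) =
        ((|Real.cos (t / 2)| : ℝ) : ℂ) * ((b ^ _ : Circle) : ℂ)
      rw [h2, neg_div, Real.cos_neg]
  · by_cases h : ∃ n : ℤ, t / (2 * Real.pi) = n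
    · obtain ⟨n, hn⟩ := h
      simp [torusFrame, neg_div, sin_half_eq_zero hn]
    · push Not at h
      have h2 : b⁻¹ ^ (2 * ⌊-t / (2 * Real.pi)⌋ + 1) = b ^ (2 * ⌊t / (2 * Real.pi)⌋ + 1) := by
        rw [neg_div, floor_neg_of_not_int h, inv_zpow']
        congr 1
        ring
      change ((|Real.sin (-t / 2)| : ℝ) : ℂ) * ((b⁻¹ ^ _ : Circle) : ℂ) =
        ((|Real.sin (t / 2)| : ℝ) : ℂ) * ((b ^ _ : Circle) : ℂ)
      rw [h2, neg_div, Real.sin_neg, abs_neg]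

open InnerProductSpace in
/-- The projections onto the lines spanned by the frame form a continuous family on the 2-torus
which is invariant under inversion. -/
lemma exists_torus_projection :
    ∃ P : C(Circle × Circle, EuclideanSpace ℂ (Fin 2) →L[ℂ] EuclideanSpace ℂ (Fin 2)),
      (∀ t b, P (Circle.exp t, b) = rankOne ℂ (torusFrame t b) (torusFrame t b)) ∧
      ∀ a b, P (a⁻¹, b⁻¹) = P (a, b) := by
  have hc : Continuous fun q : ℝ × Circle => ContinuousLinearMap.smulRightL ℂ
      (EuclideanSpace ℂ (Fin 2)) _ (innerSL ℂ (torusFrame q.1 q.2)) (torusFrame q.1 q.2) :=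
    ((ContinuousLinearMap.smulRightL ℂ _ _).continuous.comp
      ((innerSL ℂ).continuous.comp continuous_torusFrame)).clm_apply continuous_torusFrame
  let R : C(ℝ × Circle, EuclideanSpace ℂ (Fin 2) →L[ℂ] EuclideanSpace ℂ (Fin 2)) :=
    ⟨fun q => rankOne ℂ (torusFrame q.1 q.2) (torusFrame q.1 q.2), hc⟩
  have hRv : ∀ t b, R (t, b) = rankOne ℂ (torusFrame t b) (torusFrame t b) := fun _ _ => rfl
  -- A rank one projection does not change when its vector is multiplied by the unit scalar `b²`.
  have hR : ∀ b, Function.Periodic (fun t => R (t, b)) (2 * Real.pi) := fun b t => by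
    have hb : (b : ℂ) ^ 2 * (starRingEnd ℂ) ((b : ℂ) ^ 2) = 1 := by
      rw [Complex.mul_conj, Complex.normSq_eq_norm_sq, norm_pow, Circle.norm_coe]
      simp
    ext1 v
    simp only [hRv, torusFrame_add_two_pi, rankOne_apply, inner_smul_left, smul_smul]
    congr 1
    linear_combination (⟪torusFrame t b, v⟫_ℂ) * hb
  have hq : IsOpenQuotientMap (fun t : ℝ => Circle.exp t) :=
    ⟨Circle.exp_surjective, Circle.exp.continuous, isLocalHomeomorph_circleExp.isOpenMap⟩
  let e : C(ℝ × Circle, Circle × Circle) := Circle.exp.prodMap (.id _)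
  have he : Topology.IsQuotientMap e := (hq.prodMap .id).isQuotientMap
  have hf : Function.FactorsThrough R e := fun ⟨t, b⟩ ⟨t', b'⟩ h => by
    obtain ⟨h1, rfl⟩ := Prod.mk.inj h
    obtain ⟨m, hm⟩ := Circle.exp_eq_exp.1 h1
    rw [hm]
    exact (hR b).int_mul m t'
  have hP : ∀ t b, he.lift R hf (Circle.exp t, b) = R (t, b) := fun t b =>
    DFunLike.congr_fun (he.lift_comp R hf) (t, b)
  refine ⟨he.lift R hf, hP, fun a b => ?_⟩
  obtain ⟨t, rfl⟩ := Circle.exp_surjective a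
  rw [← Circle.exp_neg, hP, hP]
  rw [hRv, hRv, torusFrame_neg_inv]

/-- On a double branched cover of the 3-sphere, twice the cup product of two classes of degree one
vanishes. -/
theorem IsDoubleBranchedCover.two_smul_cupCochain_mem_coboundaries {Y : Type} [TopologicalSpace Y]
    {n : ℕ} {L : SmoothLink n} {p : Y → ThreeSphere} (hp : IsDoubleBranchedCover L p)
    {φ ψ : Singular.SingularCochain Y 1} (hφ : φ ∈ SimplicialCohomology.cocycles _ 1)
    (hψ : ψ ∈ SimplicialCohomology.cocycles _ 1) :
    (2 : ℤ) • SimplicialCohomology.cupCochain (show 1 + 1 = 2 from rfl) φ ψ ∈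
      SimplicialCohomology.coboundaries _ 2 := by
  obtain ⟨hq, τ, hpτ, hττ, hτ⟩ := hp.exists_deck_involution
  obtain ⟨a, A, ha, haτ⟩ := hp.exists_represents_inv hpτ hττ hτ hφ
  obtain ⟨b, B, hb, hbτ⟩ := hp.exists_represents_inv hpτ hττ hτ hψ
  obtain ⟨P, hP, hPinv⟩ := exists_torus_projection
  -- The involution inverts both `a` and `b`, and `P` is even, so the family of lines descends to
  -- the 3-sphere.
  obtain ⟨Q, hQ⟩ := hp.exists_descent hτ (P.comp (a.prodMk b)) fun y => by
    simp only [ContinuousMap.comp_apply, ContinuousMap.prod_eval, haτ, hbτ, hPinv]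
  have hQ' : ∀ y t v, Circle.exp t = a y →
      Q (p y) v = ⟪torusFrame t (b y), v⟫_ℂ • torusFrame t (b y) := fun y t v ht => by
    rw [hQ, ContinuousMap.comp_apply, ContinuousMap.prod_eval, ← ht, hP,
      InnerProductSpace.rankOne_apply]
  obtain ⟨s, hs⟩ : ∃ s : C(ThreeSphere, EuclideanSpace ℂ (Fin 2)),
      ∀ x, s x ≠ 0 ∧ Q x (s x) = s x :=
    exists_section_sphere (by simp) Q fun x => by
      obtain ⟨y, rfl⟩ := hq.surjective x
      exact ⟨_, norm_torusFrame _ _, fun v => hQ' y _ v (ha.exp_arg y)⟩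
  -- Where `exp (i t) = a y`, the frame spans the line that contains `s (p y) ≠ 0`, so this inner
  -- product is nonzero; being linear in the frame, it inherits the factor `b²`.
  have hG : Continuous fun q : Y × ℝ => ⟪s (p q.1), torusFrame q.2 (b q.1)⟫_ℂ := by
    have h1 : Continuous fun q : Y × ℝ => s (p q.1) :=
      s.continuous.comp (hp.continuous.comp continuous_fst)
    have h2 : Continuous fun q : Y × ℝ => torusFrame q.2 (b q.1) :=
      Continuous.comp (g := fun q : ℝ × Circle => torusFrame q.1 q.2)
        (f := fun q : Y × ℝ => (q.2, b q.1)) continuous_torusFrame (by fun_prop)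
    exact Continuous.inner (𝕜 := ℂ) h1 h2
  refine Singular.two_smul_cupCochain_mem_coboundaries hφ ha hb ⟨_, hG⟩
    (fun y t ht h => ?_) fun y t => ?_
  · obtain ⟨h1, h2⟩ := hs (p y)
    rw [hQ' y t _ ht, inner_eq_zero_symm.1 h, zero_smul] at h2
    exact h1 h2.symm
  · simp only [ContinuousMap.coe_mk, torusFrame_add_two_pi, inner_smul_right]
    ring

/-- The triple cup product form of a double branched cover of the 3-sphere vanishes. The argument
does not depend on the choice of the class `μ`, since already `2 α ∪ β = 0`. -/
theorem lemma5p2 {n : ℕ} (L : SmoothLink n) {Y : Type} [TopologicalSpace Y]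
    (p : Y → ThreeSphere) (hp : IsDoubleBranchedCover L p)
    (μ : Singular.Homology Y 3) (hμ : Singular.IsFundamentalClass μ)
    (α β γ : Singular.Cohomology Y 1) :
    Singular.tripleCupForm μ α β γ = 0 := by
  obtain ⟨φ, rfl⟩ := QuotientAddGroup.mk_surjective α
  obtain ⟨ψ, rfl⟩ := QuotientAddGroup.mk_surjective β
  exact Singular.tripleCupForm_eq_zero μ φ ψ γ
    (hp.two_smul_cupCochain_mem_coboundaries φ.2 ψ.2)
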